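/- Let $k$ be a field and let $n,c\ge 0$ be integers. Let $\mathrm{CM}(n,c)$ be the category whose objects are the pairs $(\mathbb N^r,\mathbf a)$, where $r\ge 0$ and $\mathbf a=(a_1,\dots,a_n)$ is an $n$-tuple of elements of $\mathbb N^r$ such that none of the monomials $x^{a_1},\dots,x^{a_n}$ of $k[x_1,\dots,x_r]$ divides another one and such that, for the ideal $I=(x^{a_1},\dots,x^{a_n})$, the quotient ring $k[x_1,\dots,x_r]/I$ is a (nonzero) Cohen-Macaulay ring of codimension $c$, i.e. $I$ has height $c$. A morphism $(\mathbb N^s,\mathbf b)\to(\mathbb N^r,\mathbf a)$ is a semigroup homomorphism $\phi:\mathbb N^s\to\mathbb N^r$ with $\phi(b_i)=a_i$ for all $i$. An object $(\mathbb N^r,\mathbf a)$ of $\mathrm{CM}(n,c)$ is called maximal if for every morphism $\phi:(\mathbb N^s,\mathbf b)\to(\mathbb N^r,\mathbf a)$ in $\mathrm{CM}(n,c)$ the map $\phi:\mathbb N^s\to\mathbb N^r$ is surjective and there is a morphism $\psi:(\mathbb N^r,\mathbf a)\to(\mathbb N^s,\mathbf b)$ such that $\phi\circ\psi$ is the identity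 on $\mathbb N^r$. Then the set of maximal objects of $\mathrm{CM}(n,c)$ is finite, and each maximal object consists of squarefree monomials. Moreover, for every object $(\mathbb N^r,\mathbf a)$ of $\mathrm{CM}(n,c)$ there is a morphism in $\mathrm{CM}(n,c)$ from some maximal object to $(\mathbb N^r,\mathbf a)$. -/

import Mathlib

open CategoryTheory

/-- A Cohen-Macaulay local ring: a Noetherian local ring whose depth equals its Krull dimension,
i.e. (the depth never exceeding the dimension) whose maximal ideal contains a regular sequence
of length the Krull dimension. -/
def IsCohenMacaulayLocal (R : Type*) [CommRing R] [IsLocalRing R] : Prop :=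
  IsNoetherianRing R ∧
    ∃ rs : List R, (∀ x ∈ rs, x ∈ IsLocalRing.maximalIdeal R) ∧
      RingTheory.Sequence.IsRegular R rs ∧
      ((rs.length : ℕ∞) : WithBot ℕ∞) = ringKrullDim R

/-- A Cohen-Macaulay ring: a Noetherian ring all of whose local rings are Cohen-Macaulay. -/
def IsCohenMacaulayRing (R : Type*) [CommRing R] : Prop :=
  IsNoetherianRing R ∧
    ∀ (P : Ideal R) [P.IsPrime], IsCohenMacaulayLocal (Localization.AtPrime P)

/-- A pair `(ℕ^r, a)`, where `a` is an `n`-tuple of elements of `ℕ^r`. The element `a i` is the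
exponent vector of the monomial `x^(a i)` in the variables `x_p`, `p : Fin r`. -/
structure MonTuple (n : ℕ) where
  /-- the number `r` of variables -/
  rank : ℕ
  /-- the exponent vectors -/
  gen : Fin n → (Fin rank →₀ ℕ)

namespace MonTuple

variable {n : ℕ}

/-- A morphism `(ℕ^r, a) → (ℕ^s, b)`: a semigroup homomorphism `ℕ^r → ℕ^s` (it preserves `0`
automatically, addition in `ℕ^s` being cancellative) which sends `a i` to `b i` for all `i`. -/
@[ext]
structure Hom (A B : MonTuple n) where
  /-- the underlying homomorphism `ℕ^r → ℕ^s` -/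
  toHom : (Fin A.rank →₀ ℕ) →+ (Fin B.rank →₀ ℕ)
  map_gen : ∀ i, toHom (A.gen i) = B.gen i

/-- The category `Mon(n)`. -/
noncomputable instance : Category (MonTuple n) where
  Hom A B := Hom A B
  id A := ⟨AddMonoidHom.id _, fun _ => rfl⟩
  comp f g := ⟨g.toHom.comp f.toHom, fun i => by simp [f.map_gen, g.map_gen]⟩

/-- None of the monomials `x^(a i)` divides another one, i.e. they are the `n` minimal monomial
generators of the ideal which they generate. (Divisibility of monomials is the
coordinatewise order on exponent vectors.) -/
def IsMinimal (A : MonTuple n) : Prop :=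
  ∀ i j, i ≠ j → ¬ A.gen i ≤ A.gen j

/-- The ideal of `k[x_1, …, x_r]` generated by the monomials `x^(a i)`. -/
noncomputable def ideal (k : Type*) [Field k] (A : MonTuple n) :
    Ideal (MvPolynomial (Fin A.rank) k) :=
  Ideal.span (Set.range fun i => MvPolynomial.monomial (A.gen i) (1 : k))

/-- All the monomials `x^(a i)` are squarefree. -/
def IsSquarefree (A : MonTuple n) : Prop :=
  ∀ i p, A.gen i p ≤ 1

end MonTuple

/-- The monomials `x^(a i)` minimally generate an ideal `I` whose quotient ring
`k[x_1, …, x_r]/I` is Cohen-Macaulay of codimension `c`. The codimension of the quotient ring is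
the height of `I`; the height of the unit ideal is `⊤`, so the zero ring is excluded. -/
def isCM (k : Type*) [Field k] (n c : ℕ) : ObjectProperty (MonTuple n) := fun A =>
  A.IsMinimal ∧
    IsCohenMacaulayRing (MvPolynomial (Fin A.rank) k ⧸ A.ideal k) ∧
    (A.ideal k).height = (c : ℕ∞)

/-- The category `CM(n,c)`, a full subcategory of `Mon(n)`. -/
abbrev CMCat (k : Type*) [Field k] (n c : ℕ) : Type := (isCM k n c).FullSubcategory

/-- An object `(ℕ^r, a)` of `CM(n,c)` is maximal if every morphism `φ` to it in `CM(n,c)` is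
surjective as a map `ℕ^s → ℕ^r` and is split by a morphism `ψ` in `CM(n,c)`: `φ ∘ ψ` is the
identity. -/
def CMCat.IsMaximal {k : Type*} [Field k] {n c : ℕ} (A : CMCat k n c) : Prop :=
  ∀ (B : CMCat k n c) (φ : B ⟶ A),
    Function.Surjective φ.hom.toHom ∧ ∃ ψ : A ⟶ B, ψ ≫ φ = 𝟙 A

-- Polarization maps a squarefree family onto any given one: a factor `x_j` of each generator
-- divisible by `x_j` is traded for a new variable `y`, and the old quotient is the new one modulo
-- `y - x_j`, which is a nonzerodivisor (`mem_monomialIdeal_polarize_of_mul_mem`). Hence the new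
-- quotient is Cohen-Macaulay at the origin, and for monomial ideals this suffices
-- (`isCohenMacaulayRing_of_origin`): where some `x_j` is invertible, the quotient is locally a
-- polynomial ring over the quotient with `x_j = 1`. A variable can be dropped by setting it to `1`
-- whenever the old generators are recovered by a homomorphism. Cohen-Macaulayness survives because
-- this is a localization followed by descent from a polynomial ring. The codimension survives
-- because all minimal covers of a Cohen-Macaulay monomial ideal have the same size
-- (`card_le_card_of_minimal_cover`). Dropping one of two variables that occur in the same
-- generators leaves at most `2 ^ n` variables, so finitely many squarefree objects suffice to
-- dominate all objects. Over a given object take one, `B`, that is minimal for the existence of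
-- morphisms and then for rank. No variable of `B` can be dropped, so its only endomorphism is the
-- identity (`endomorphism_eq_id`). Any `C ⟶ B` is dominated by a bounded squarefree `D ⟶ C`,
-- minimality gives `B ⟶ D`, and the round trip `B ⟶ D ⟶ C ⟶ B` must be the identity: `B` is
-- maximal. Conversely a maximal object is a retract of a squarefree one, hence squarefree, and
-- surjectivity forbids two variables occurring in the same generators, so the bound `2 ^ n` applies
-- to it as well.

universe u v

/-! ### Cohen-Macaulay local rings: regular quotients, unmixedness, localization. -/

section LocalRings

open RingTheory.Sequence IsLocalRing

open Pointwise in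
/-- The quotient of a ring by a principal ideal, compared with any surjective image with the same
kernel. -/
noncomputable def quotSMulTopEquivOfSurjective {R : Type u} {S : Type v} [CommRing R] [CommRing S]
    (f : R →+* S) (hf : Function.Surjective f) {x : R} (hker : RingHom.ker f = Ideal.span {x}) :
    QuotSMulTop x R ≃+ S :=
  (Submodule.quotEquivOfEq (x • (⊤ : Submodule R R)) (RingHom.ker f : Submodule R R) (by
    rw [hker, ← Submodule.ideal_span_singleton_smul, smul_eq_mul, Ideal.mul_top])).toAddEquiv.trans
    (RingHom.quotientKerEquivOfSurjective hf).toAddEquiv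

theorem quotSMulTopEquivOfSurjective_smul {R : Type u} {S : Type v} [CommRing R] [CommRing S]
    (f : R →+* S) (hf : Function.Surjective f) {x : R} (hker : RingHom.ker f = Ideal.span {x})
    (r : R) (y : QuotSMulTop x R) :
    quotSMulTopEquivOfSurjective f hf hker (r • y) =
      f r • quotSMulTopEquivOfSurjective f hf hker y := by
  obtain ⟨y, rfl⟩ := Submodule.Quotient.mk_surjective _ y
  exact map_mul f r y

theorem isRegular_quotSMulTop_iff {R : Type u} {S : Type v} [CommRing R] [CommRing S]
    (f : R →+* S) (hf : Function.Surjective f) {x : R} (hker : RingHom.ker f = Ideal.span {x})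
    (rs : List R) : IsRegular (QuotSMulTop x R) rs ↔ IsRegular S (rs.map f) :=
  (quotSMulTopEquivOfSurjective f hf hker).isRegular_congr <|
    List.forall₂_map_right_iff.mpr <| List.forall₂_same.mpr fun r _ y =>
      quotSMulTopEquivOfSurjective_smul f hf hker r y

namespace IsCohenMacaulayLocal

theorem of_ringEquiv {R : Type u} {S : Type v} [CommRing R] [CommRing S] [IsLocalRing R]
    [IsLocalRing S] (e : R ≃+* S) (h : IsCohenMacaulayLocal R) : IsCohenMacaulayLocal S := by
  obtain ⟨hN, rs, hmem, hreg, hdim⟩ := h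
  refine ⟨isNoetherianRing_of_ringEquiv R e, rs.map e, ?_, ?_, ?_⟩
  · intro y hy
    obtain ⟨x, hx, rfl⟩ := List.mem_map.mp hy
    have := hmem x hx
    rw [mem_maximalIdeal, mem_nonunits_iff] at this ⊢
    rwa [MulEquiv.isUnit_map]
  · refine (e.toAddEquiv.isRegular_congr ?_).mp hreg
    exact List.forall₂_map_right_iff.mpr <| List.forall₂_same.mpr fun r _ y => map_mul e r y
  · rw [List.length_map, hdim, ringKrullDim_eq_of_ringEquiv e]

theorem of_ringKrullDim_eq_zero {R : Type u} [CommRing R] [IsLocalRing R] [IsNoetherianRing R]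
    (h : ringKrullDim R = 0) : IsCohenMacaulayLocal R :=
  ⟨inferInstance, [], by simp, IsRegular.nil _ _, by simp [h]⟩

theorem ringKrullDim_add_one {R : Type u} {S : Type v} [CommRing R] [CommRing S] [IsLocalRing R]
    [IsNoetherianRing R] (f : R →+* S) (hf : Function.Surjective f) {x : R}
    (hx : x ∈ maximalIdeal R) (hreg : IsSMulRegular R x)
    (hker : RingHom.ker f = Ideal.span {x}) : ringKrullDim S + 1 = ringKrullDim R := by
  rw [← ringKrullDim_quotient_span_singleton_succ_eq_ringKrullDim hreg hx,
    ringKrullDim_eq_of_ringEquiv ((Ideal.quotEquivOfEq hker.symm).trans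
      (RingHom.quotientKerEquivOfSurjective hf))]

theorem of_isRegular_length {R : Type u} [CommRing R] [IsLocalRing R] [IsNoetherianRing R]
    (rs : List R) (hmem : ∀ x ∈ rs, x ∈ maximalIdeal R) (h : IsRegular R rs)
    (hdim : ((rs.length : ℕ∞) : WithBot ℕ∞) = ringKrullDim R) : IsCohenMacaulayLocal R :=
  ⟨inferInstance, rs, hmem, h, hdim⟩

/-- Lift a maximal regular sequence and put `x` in front: length and dimension both grow by one. -/
theorem of_quotient {R : Type u} {S : Type v} [CommRing R] [CommRing S] [IsLocalRing R]
    [IsLocalRing S] [IsNoetherianRing R] (f : R →+* S) (hf : Function.Surjective f) {x : R}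
    (hx : x ∈ maximalIdeal R) (hreg : IsSMulRegular R x)
    (hker : RingHom.ker f = Ideal.span {x}) (h : IsCohenMacaulayLocal S) :
    IsCohenMacaulayLocal R := by
  obtain ⟨-, rs, hmem, hrs, hdim⟩ := h
  obtain ⟨rs, rfl⟩ := List.map_surjective_iff.mpr hf rs
  refine ⟨inferInstance, x :: rs, ?_, ?_, ?_⟩
  · have := hf.isLocalHom f
    intro y hy
    rcases List.mem_cons.mp hy with rfl | hy
    · exact hx
    · have := hmem _ (List.mem_map_of_mem hy)
      rw [mem_maximalIdeal, mem_nonunits_iff] at this ⊢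
      exact fun hu => this (hu.map f)
  · rw [isRegular_cons_iff, isRegular_quotSMulTop_iff f hf hker]
    exact ⟨hreg, hrs⟩
  · rw [← ringKrullDim_add_one f hf hx hreg hker, ← hdim]
    simp

-- The given regular sequence need not start with `x`, so depth is measured homologically, by the
-- vanishing of `Ext` from the residue field. The long exact sequence of multiplication by `x` costs
-- exactly one degree.
open Abelian Pointwise in
theorem quotient {R : Type u} {S : Type v} [CommRing R] [CommRing S] [IsLocalRing R]
    [IsLocalRing S] (f : R →+* S) (hf : Function.Surjective f) {x : R}
    (hx : x ∈ maximalIdeal R) (hreg : IsSMulRegular R x)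
    (hker : RingHom.ker f = Ideal.span {x}) (h : IsCohenMacaulayLocal R) :
    IsCohenMacaulayLocal S := by
  obtain ⟨hN, rs, hmem, hrs, hdim⟩ := h
  have hdim' := ringKrullDim_add_one f hf hx hreg hker
  have hS : IsNoetherianRing S := isNoetherianRing_of_surjective R S f hf
  have hm : ∀ M : Type u, [AddCommGroup M] → [Module R M] → [Module.Finite R M] → [Nontrivial M] →
      maximalIdeal R • (⊤ : Submodule R M) < ⊤ := fun M _ _ _ _ =>
    lt_top_iff_ne_top.mpr (Submodule.top_ne_ideal_smul_of_le_jacobson_annihilator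
      (maximalIdeal_le_jacobson _)).symm
  have hsupp : Module.support R (R ⧸ maximalIdeal R) =
      PrimeSpectrum.zeroLocus (maximalIdeal R : Set R) := by
    rw [Module.support_eq_zeroLocus, Ideal.annihilator_quotient]
  have hext := ModuleCat.subsingleton_ext_of_exists_isRegular (maximalIdeal R)
    (ModuleCat.of R (R ⧸ maximalIdeal R)) hsupp.subset (ModuleCat.of R R) (hm R) rs hmem hrs
  have : Nontrivial (QuotSMulTop x R) := nontrivial_quotSMulTop_of_mem_maximalIdeal R hx
  -- Degree `i` of the quotient is squeezed between degrees `i` and `i + 1` of `R`, so `i + 1 <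
  -- rs.length` is what is needed. The truncated subtraction is harmless, as `rs.length = dim S +
  -- 1`.
  obtain ⟨ts, hlen, htm, hts⟩ := ModuleCat.exists_isRegular_of_exists_subsingleton_ext
    (maximalIdeal R) (rs.length - 1) (ModuleCat.of R (QuotSMulTop x R)) (hm _)
    (ModuleCat.of R (R ⧸ maximalIdeal R)) hsupp (by
      intro i hi
      have zero1 := AddCommGrpCat.isZero_of_iff_subsingleton.mpr (hext i (by lia))
      have zero2 := AddCommGrpCat.isZero_of_iff_subsingleton.mpr (hext (i + 1) (by lia))
      have hreg' : IsSMulRegular (ModuleCat.of R R) x := hreg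
      exact AddCommGrpCat.subsingleton_of_isZero <| ShortComplex.Exact.isZero_of_both_zeros
        ((Ext.covariant_sequence_exact₃' (ModuleCat.of R (R ⧸ maximalIdeal R))
          hreg'.smulShortComplex_shortExact) i (i + 1) rfl)
        (zero1.eq_zero_of_src _) (zero2.eq_zero_of_tgt _))
  have hloc := hf.isLocalHom f
  refine of_isRegular_length (ts.map f) ?_ ((isRegular_quotSMulTop_iff f hf hker ts).mp hts) ?_
  · intro y hy
    obtain ⟨t, ht, rfl⟩ := List.mem_map.mp hy
    have := htm t ht
    rw [mem_maximalIdeal, mem_nonunits_iff] at this ⊢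
    exact fun hu => this (isUnit_of_map_unit f _ hu)
  · rw [← hdim] at hdim'
    have h0 := ringKrullDim_nonneg_of_nontrivial (R := S)
    obtain ⟨d, hd⟩ : ∃ d : ℕ∞, (d : WithBot ℕ∞) = ringKrullDim S :=
      WithBot.ne_bot_iff_exists.mp fun hbot => by simp [hbot] at h0
    rw [← hd] at hdim' ⊢
    rw [List.length_map, hlen]
    norm_cast at hdim' ⊢
    have hd' : d ≠ ⊤ := by rintro rfl; simp at hdim'
    lift d to ℕ using hd'
    norm_cast at hdim' ⊢
    lia

end IsCohenMacaulayLocal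

namespace IsCohenMacaulayLocal

theorem exists_isSMulRegular {R : Type u} [CommRing R] [IsLocalRing R]
    (h : IsCohenMacaulayLocal R) (hdim : ringKrullDim R ≠ 0) :
    ∃ x ∈ maximalIdeal R, IsSMulRegular R x := by
  obtain ⟨-, rs, hmem, hrs, hlen⟩ := h
  cases rs with
  | nil => simp at hlen; exact absurd hlen.symm hdim
  | cons x rs =>
    exact ⟨x, hmem x (by simp), ((isRegular_cons_iff R x rs).mp hrs).1⟩

theorem exists_ringKrullDim_eq {R : Type u} [CommRing R] [IsLocalRing R]
    (h : IsCohenMacaulayLocal R) : ∃ n : ℕ, ringKrullDim R = n := by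
  obtain ⟨-, rs, -, -, hlen⟩ := h
  exact ⟨rs.length, hlen.symm.trans (by simp)⟩

end IsCohenMacaulayLocal

/-- In a local Noetherian ring a nonzero element can be divided by a regular nonunit only finitely
often. -/
theorem exists_eq_pow_mul_not_mem_span {R : Type u} [CommRing R] [IsLocalRing R]
    [IsNoetherianRing R] {x z : R} (hx : x ∈ maximalIdeal R) (hz : z ≠ 0) :
    ∃ (k : ℕ) (w : R), z = x ^ k * w ∧ w ∉ Ideal.span {x} := by
  classical
  have hne : Ideal.span {x} ≠ ⊤ := fun h => by
    rw [Ideal.span_singleton_eq_top] at h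
    exact hx h
  have hex : ∃ k, z ∉ Ideal.span {x} ^ k := by
    by_contra! hcon
    have : z ∈ (⨅ i : ℕ, Ideal.span {x} ^ i : Ideal R) := by simpa [Ideal.mem_iInf] using hcon
    rw [Ideal.iInf_pow_eq_bot_of_isLocalRing _ hne] at this
    exact hz this
  obtain ⟨k, hk⟩ : ∃ k, Nat.find hex = k + 1 :=
    Nat.exists_eq_succ_of_ne_zero fun h0 => by
      have := Nat.find_spec hex
      rw [h0] at this
      simp at this
  have hlt : z ∈ Ideal.span {x} ^ k := not_not.mp (Nat.find_min hex (m := k) (by lia))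
  rw [Ideal.span_singleton_pow, Ideal.mem_span_singleton] at hlt
  obtain ⟨w, rfl⟩ := hlt
  refine ⟨k, w, rfl, fun hw => ?_⟩
  have := Nat.find_spec hex
  rw [hk] at this
  obtain ⟨v, rfl⟩ := Ideal.mem_span_singleton.mp hw
  apply this
  rw [Ideal.span_singleton_pow, Ideal.mem_span_singleton]
  exact ⟨v, by ring⟩

/-- Induction on the dimension. Write `p` as the annihilator of `z` and divide `z` by a regular `x`
as often as possible. The result `w` is still killed by `p` but is nonzero modulo `x`, so the image
of `p` lies in an associated prime `Q` of `R/x`. As `x ∉ p`, passing from `R/p` to `(R/x)/Q` loses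
at least one dimension. -/
theorem IsCohenMacaulayLocal.le_ringKrullDim_quotient {R : Type u} [CommRing R] [IsLocalRing R]
    (h : IsCohenMacaulayLocal R) {p : Ideal R} (hp : p ∈ associatedPrimes R R) :
    ringKrullDim R ≤ ringKrullDim (R ⧸ p) := by
  obtain ⟨n, hn⟩ := h.exists_ringKrullDim_eq
  induction n generalizing R with
  | zero =>
    have := hp.isPrime
    rw [hn]
    exact ringKrullDim_nonneg_of_nontrivial
  | succ n ih =>
    have hN := h.1
    have := hp.isPrime
    obtain ⟨x, hx, hreg⟩ := h.exists_isSMulRegular (by rw [hn]; exact_mod_cast n.succ_ne_zero)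
    obtain ⟨-, z, hz⟩ := isAssociatedPrime_iff.mp hp
    have hz0 : z ≠ 0 := by
      rintro rfl
      exact Ideal.IsPrime.ne_top' (hz.trans (by simp))
    obtain ⟨k, w, hzw, hw⟩ := exists_eq_pow_mul_not_mem_span hx hz0
    have hpw : ∀ a ∈ p, a * w = 0 := by
      intro a ha
      rw [hz, Submodule.mem_colon_singleton, Submodule.mem_bot, smul_eq_mul, hzw] at ha
      refine (hreg.pow k).right_eq_zero_of_smul ?_
      rw [smul_eq_mul, ← ha]
      ring
    have hxp : x ∉ p := fun hxp => hw (by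
      have := hreg.right_eq_zero_of_smul (hpw x hxp)
      simp [this])
    have hsurj := Ideal.Quotient.mk_surjective (I := Ideal.span {x})
    have : Nontrivial (R ⧸ Ideal.span {x}) := Ideal.Quotient.nontrivial_iff.mpr fun h => by
      rw [Ideal.span_singleton_eq_top] at h
      exact hx h
    have : IsLocalRing (R ⧸ Ideal.span {x}) := .of_surjective' _ hsurj
    have hQ := h.quotient _ hsurj hx hreg Ideal.mk_ker
    have hd := IsCohenMacaulayLocal.ringKrullDim_add_one _ hsurj hx hreg Ideal.mk_ker
    have hd' : ringKrullDim (R ⧸ Ideal.span {x}) = n := by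
      obtain ⟨m, hm⟩ := hQ.exists_ringKrullDim_eq
      rw [hm, hn] at hd
      rw [hm]
      norm_cast at hd ⊢
      lia
    obtain ⟨Q, hQass, hQle⟩ := exists_le_isAssociatedPrime_of_isNoetherianRing
      (R ⧸ Ideal.span {x}) (Ideal.Quotient.mk (Ideal.span {x}) w)
      (by rwa [Ne, Ideal.Quotient.eq_zero_iff_mem])
    have := hQass.isPrime
    have key := ih hQ hQass hd'
    have hle : ∀ a ∈ p, (Ideal.Quotient.mk Q).comp (Ideal.Quotient.mk (Ideal.span {x})) a = 0 := by
      intro a ha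
      rw [RingHom.comp_apply, Ideal.Quotient.eq_zero_iff_mem]
      apply hQle
      rw [Submodule.mem_colon_singleton, Submodule.mem_bot, smul_eq_mul, ← map_mul, hpw a ha,
        map_zero]
    have hstep := ringKrullDim_succ_le_of_surjective (Ideal.Quotient.lift p _ hle)
      (Ideal.Quotient.lift_surjective_of_surjective _ hle
        (Ideal.Quotient.mk_surjective.comp hsurj)) (r := Ideal.Quotient.mk p x)
      (mem_nonZeroDivisors_of_ne_zero (by rwa [Ne, Ideal.Quotient.eq_zero_iff_mem]))
      (by
        have : Ideal.Quotient.mk (Ideal.span {x}) x = 0 :=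
          Ideal.Quotient.eq_zero_iff_mem.mpr (Ideal.mem_span_singleton_self x)
        simp [this])
    refine le_trans ?_ hstep
    rw [← hd]
    gcongr

section Localization

variable {R : Type u} {S : Type v} [CommRing R] [CommRing S]

theorem Ideal.map_primeCompl_comap {f : R →+* S} (hf : Function.Surjective f) (P : Ideal S)
    [P.IsPrime] : (P.comap f).primeCompl.map f = P.primeCompl := by
  ext y
  constructor
  · rintro ⟨x, hx, rfl⟩
    exact hx
  · intro hy
    obtain ⟨x, rfl⟩ := hf y
    exact ⟨x, hy, rfl⟩

theorem Localization.localRingHom_surjective {f : R →+* S} (hf : Function.Surjective f)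
    (P : Ideal S) [P.IsPrime] :
    Function.Surjective (Localization.localRingHom (P.comap f) P f rfl) := by
  have : IsLocalization ((P.comap f).primeCompl.map f) (Localization.AtPrime P) := by
    rw [Ideal.map_primeCompl_comap hf]; infer_instance
  exact IsLocalization.map_surjective_of_surjective _ _ _ hf

theorem Localization.ker_localRingHom {f : R →+* S} (hf : Function.Surjective f)
    (P : Ideal S) [P.IsPrime] :
    RingHom.ker (Localization.localRingHom (P.comap f) P f rfl) =
      (RingHom.ker f).map (algebraMap R (Localization.AtPrime (P.comap f))) :=
  IsLocalization.ker_map _ _ (Ideal.map_primeCompl_comap hf P)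

theorem IsSMulRegular.localization {x : R} (hx : IsSMulRegular R x) (P : Ideal R) [P.IsPrime] :
    IsSMulRegular (Localization.AtPrime P) (algebraMap R (Localization.AtPrime P) x) := by
  have := (IsWeaklyRegular.of_isLocalization (Localization.AtPrime P) P.primeCompl
    (rs := [x]) ((isWeaklyRegular_singleton_iff R x).mpr hx))
  simpa using this

/-- Cohen-Macaulayness of local rings and quotients by a regular element. -/
theorem isCohenMacaulayLocal_localization_iff_of_regular [IsNoetherianRing R] {f : R →+* S}
    (hf : Function.Surjective f) {x : R} (hreg : IsSMulRegular R x)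
    (hker : RingHom.ker f = Ideal.span {x}) (P : Ideal S) [P.IsPrime] :
    IsCohenMacaulayLocal (Localization.AtPrime P) ↔
      IsCohenMacaulayLocal (Localization.AtPrime (P.comap f)) := by
  have hsurj := Localization.localRingHom_surjective hf P
  have hker' := Localization.ker_localRingHom hf P
  rw [hker, Ideal.map_span, Set.image_singleton] at hker'
  have hxP : x ∈ P.comap f := by
    have : x ∈ RingHom.ker f := hker ▸ Ideal.mem_span_singleton_self x
    rw [Ideal.mem_comap, (RingHom.mem_ker).mp this]
    exact P.zero_mem
  have hmem : algebraMap R (Localization.AtPrime (P.comap f)) x ∈ maximalIdeal _ :=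
    (IsLocalization.AtPrime.to_map_mem_maximal_iff _ (P.comap f) x).mpr hxP
  have := IsLocalization.isNoetherianRing (P.comap f).primeCompl
    (Localization.AtPrime (P.comap f)) inferInstance
  exact ⟨fun h => h.of_quotient _ hsurj hmem (hreg.localization _) hker',
    fun h => h.quotient _ hsurj hmem (hreg.localization _) hker'⟩

/-- Local rings do not see a kernel which vanishes locally. -/
theorem isCohenMacaulayLocal_localization_iff_of_ker {f : R →+* S}
    (hf : Function.Surjective f) (P : Ideal S) [P.IsPrime]
    (hker : ∀ x, f x = 0 → ∃ s ∉ P.comap f, s * x = 0) :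
    IsCohenMacaulayLocal (Localization.AtPrime P) ↔
      IsCohenMacaulayLocal (Localization.AtPrime (P.comap f)) := by
  have hsurj := Localization.localRingHom_surjective hf P
  have hinj : Function.Injective (Localization.localRingHom (P.comap f) P f rfl) := by
    rw [RingHom.injective_iff_ker_eq_bot, Localization.ker_localRingHom hf, eq_bot_iff,
      Ideal.map_le_iff_le_comap]
    intro x hx
    obtain ⟨s, hs, hsx⟩ := hker x hx
    exact (IsLocalization.map_eq_zero_iff (P.comap f).primeCompl _ x).mpr ⟨⟨s, hs⟩, hsx⟩
  let e := RingEquiv.ofBijective _ ⟨hinj, hsurj⟩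
  exact ⟨fun h => h.of_ringEquiv e.symm, fun h => h.of_ringEquiv e⟩

end Localization

/-- Prime avoidance: the zero divisors are the union of the finitely many associated primes. -/
theorem exists_associatedPrime_of_forall_not_isSMulRegular {R : Type u} [CommRing R]
    [IsNoetherianRing R] (P : Ideal R) (h : ∀ x ∈ P, ¬ IsSMulRegular R x) :
    ∃ Q ∈ associatedPrimes R R, P ≤ Q := by
  refine (P.subset_union_prime_finite (associatedPrimes.finite R R) (f := id) 0 0
    fun _ h _ _ => h.isPrime).1 fun x hx => ?_
  have hzd : x ∈ {r : R | ∃ z : R, z ≠ 0 ∧ r • z = 0} := by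
    by_contra hcon
    refine h x hx (isSMulRegular_iff_right_eq_zero_of_smul.mpr fun z hz => ?_)
    by_contra hz0
    exact hcon ⟨z, hz0, hz⟩
  rw [← biUnion_associatedPrimes_eq_zero_divisors] at hzd
  simpa using hzd

theorem exists_isPrime_comap_eq {R : Type u} {S : Type v} [CommRing R] [CommRing S] {f : R →+* S}
    (hf : Function.Surjective f) (P : Ideal R) [P.IsPrime] (hP : ∀ x, f x = 0 → x ∈ P) :
    ∃ P' : Ideal S, P'.IsPrime ∧ P = P'.comap f := by
  refine ⟨P.map f, Ideal.map_isPrime_of_surjective hf hP, ?_⟩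
  rw [Ideal.comap_map_of_surjective f hf, eq_comm, sup_eq_left]
  exact hP

theorem ringKrullDim_quotient_add_one_le {R : Type u} [CommRing R] {P Q : Ideal R} [P.IsPrime]
    (hPQ : P < Q) : ringKrullDim (R ⧸ Q) + 1 ≤ ringKrullDim (R ⧸ P) := by
  obtain ⟨x, hxQ, hxP⟩ := SetLike.exists_of_lt hPQ
  exact ringKrullDim_succ_le_of_surjective (Ideal.Quotient.factor hPQ.le)
    (Ideal.Quotient.factor_surjective hPQ.le) (r := Ideal.Quotient.mk P x)
    (mem_nonZeroDivisors_of_ne_zero (by rwa [Ne, Ideal.Quotient.eq_zero_iff_mem]))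
    (by simpa [Ideal.Quotient.eq_zero_iff_mem] using hxQ)

/-- No embedded primes: `P < p` would give `dim R/p + 1 ≤ dim R/P ≤ dim R ≤ dim R/p`, with all
dimensions finite. -/
theorem IsCohenMacaulayLocal.mem_minimalPrimes {R : Type u} [CommRing R] [IsLocalRing R]
    (h : IsCohenMacaulayLocal R) {p : Ideal R} (hp : p ∈ associatedPrimes R R) :
    p ∈ minimalPrimes R := by
  have := hp.isPrime
  obtain ⟨n, hn⟩ := h.exists_ringKrullDim_eq
  refine ⟨⟨this, bot_le⟩, fun P ⟨hP, _⟩ hle => ?_⟩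
  by_contra hcon
  have h1 := (ringKrullDim_quotient_add_one_le (lt_of_le_not_ge hle hcon)).trans
    (ringKrullDim_quotient_le P)
  have h2 := h.le_ringKrullDim_quotient hp
  obtain ⟨m, hm⟩ : ∃ m : ℕ∞, (m : WithBot ℕ∞) = ringKrullDim (R ⧸ p) :=
    WithBot.ne_bot_iff_exists.mp fun hbot => by simp [hbot, hn] at h2
  rw [← hm, hn] at h1 h2
  norm_cast at h1 h2
  have : m ≠ ⊤ := by rintro rfl; simp at h1
  lift m to ℕ using this
  norm_cast at h1 h2
  lia

/-- A localization of a Cohen-Macaulay local ring is Cohen-Macaulay. -/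
theorem IsCohenMacaulayLocal.localization {R : Type u} [CommRing R] [IsLocalRing R]
    (h : IsCohenMacaulayLocal R) (P : Ideal R) [P.IsPrime] :
    IsCohenMacaulayLocal (Localization.AtPrime P) := by
  obtain ⟨n, hn⟩ := h.exists_ringKrullDim_eq
  have hN := h.1
  induction n using Nat.strong_induction_on generalizing R with
  | _ n ih =>
  by_cases hreg : ∃ x ∈ P, IsSMulRegular R x
  · obtain ⟨x, hxP, hreg⟩ := hreg
    have hsurj := Ideal.Quotient.mk_surjective (I := Ideal.span {x})
    have hx := le_maximalIdeal (Ideal.IsPrime.ne_top' (I := P)) hxP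
    have : Nontrivial (R ⧸ Ideal.span {x}) := Ideal.Quotient.nontrivial_iff.mpr fun h => by
      rw [Ideal.span_singleton_eq_top] at h
      exact hx h
    have : IsLocalRing (R ⧸ Ideal.span {x}) := .of_surjective' _ hsurj
    have hQ := h.quotient _ hsurj hx hreg Ideal.mk_ker
    have hd := IsCohenMacaulayLocal.ringKrullDim_add_one _ hsurj hx hreg Ideal.mk_ker
    obtain ⟨m, hm⟩ := hQ.exists_ringKrullDim_eq
    obtain ⟨P', hP', rfl⟩ := exists_isPrime_comap_eq hsurj P
      (by change RingHom.ker _ ≤ _; rwa [Ideal.mk_ker, Ideal.span_singleton_le_iff_mem])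
    refine (isCohenMacaulayLocal_localization_iff_of_regular hsurj hreg Ideal.mk_ker P').mp
      (ih m ?_ hQ P' hm hQ.1)
    rw [hm, hn] at hd
    norm_cast at hd
    lia
  -- A prime of zero divisors lies in an associated prime, which is minimal, so it equals it and the
  -- localization has dimension zero.
  · push Not at hreg
    obtain ⟨Q, hQ, hPQ⟩ := exists_associatedPrime_of_forall_not_isSMulRegular P hreg
    have hmin : P ∈ minimalPrimes R := by
      rw [le_antisymm hPQ ((h.mem_minimalPrimes hQ).2 ⟨‹_›, bot_le⟩ hPQ)]
      exact h.mem_minimalPrimes hQ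
    have := IsLocalization.isNoetherianRing P.primeCompl (Localization.AtPrime P) inferInstance
    apply of_ringKrullDim_eq_zero
    rw [IsLocalization.AtPrime.ringKrullDim_eq_height P, Ideal.height_eq_zero_iff.mpr hmin]
    rfl

theorem IsCohenMacaulayLocal.localization_of_le {R : Type u} [CommRing R] {p q : Ideal R}
    [p.IsPrime] [q.IsPrime] (hqp : q ≤ p) (h : IsCohenMacaulayLocal (Localization.AtPrime p)) :
    IsCohenMacaulayLocal (Localization.AtPrime q) := by
  have hdisj : Disjoint (p.primeCompl : Set R) (q : Set R) :=
    Set.disjoint_left.mpr fun x hx hxq => hx (hqp hxq)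
  have hprime := IsLocalization.isPrime_of_isPrime_disjoint p.primeCompl
    (Localization.AtPrime p) q ‹_› hdisj
  have hcomap := IsLocalization.under_map_of_isPrime_disjoint p.primeCompl
    (Localization.AtPrime p) ‹q.IsPrime› hdisj
  generalize Ideal.map (algebraMap R (Localization.AtPrime p)) q = q' at hprime hcomap
  subst hcomap
  exact (h.localization q').of_ringEquiv
    (IsLocalization.localizationLocalizationAtPrimeIsoLocalization p.primeCompl q').symm.toRingEquiv

/-! ### Ascent to and descent from polynomial rings. -/

open Polynomial

theorem IsSMulRegular.polynomial_C {R : Type u} [CommRing R] {x : R} (h : IsSMulRegular R x) :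
    IsSMulRegular R[X] (C x) := by
  intro p q hpq
  ext n
  apply h
  have := congrArg (fun p => p.coeff n) hpq
  simpa using this

theorem Polynomial.ker_mapRingHom_eq_span {R : Type u} {S : Type v} [CommRing R] [CommRing S]
    {f : R →+* S} {x : R} (hker : RingHom.ker f = Ideal.span {x}) :
    RingHom.ker (mapRingHom f) = Ideal.span {C x} := by
  rw [Polynomial.ker_mapRingHom, hker, Ideal.map_span, Set.image_singleton]

theorem Polynomial.comap_C_eq_maximalIdeal {R : Type u} {S : Type v} [CommRing R] [CommRing S]
    [IsLocalRing R] [IsLocalRing S] {f : R →+* S} (hf : Function.Surjective f) {p : Ideal S[X]}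
    (hp : (p.comap (mapRingHom f)).comap C = maximalIdeal R) : p.comap C = maximalIdeal S := by
  have hmem : ∀ r, f r ∈ p.comap C ↔ r ∈ maximalIdeal R := by
    intro r
    rw [← hp, Ideal.mem_comap, Ideal.mem_comap, Ideal.mem_comap]
    simp
  have := hf.isLocalHom f
  ext y
  obtain ⟨r, rfl⟩ := hf y
  rw [hmem, mem_maximalIdeal, mem_maximalIdeal, mem_nonunits_iff, mem_nonunits_iff,
    isUnit_map_iff]

theorem IsCohenMacaulayLocal.of_ringKrullDim_le_one {R : Type u} [CommRing R] [IsLocalRing R]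
    [IsNoetherianRing R] (h : ringKrullDim R ≤ 1) {x : R} (hx : x ∈ maximalIdeal R)
    (hreg : IsSMulRegular R x) : IsCohenMacaulayLocal R := by
  have hsurj := Ideal.Quotient.mk_surjective (I := Ideal.span {x})
  have : Nontrivial (R ⧸ Ideal.span {x}) := Ideal.Quotient.nontrivial_iff.mpr fun h => by
    rw [Ideal.span_singleton_eq_top] at h
    exact hx h
  have : IsLocalRing (R ⧸ Ideal.span {x}) := .of_surjective' _ hsurj
  refine of_quotient _ hsurj hx hreg Ideal.mk_ker (of_ringKrullDim_eq_zero ?_)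
  have hd := ringKrullDim_add_one _ hsurj hx hreg Ideal.mk_ker
  have h0 := ringKrullDim_nonneg_of_nontrivial (R := R ⧸ Ideal.span {x})
  obtain ⟨d, hd'⟩ := WithBot.ne_bot_iff_exists.mp (ne_bot_of_le_ne_bot (by simp) h0)
  rw [← hd, ← hd'] at h
  rw [← hd']
  norm_cast at h ⊢
  have : d ≠ ⊤ := by rintro rfl; simp at h
  lift d to ℕ using this
  norm_cast at h ⊢
  lia

/-- The local rings of a polynomial ring at primes over the maximal ideal of a Cohen-Macaulay
local ring. -/
theorem IsCohenMacaulayLocal.polynomial {R : Type u} [CommRing R] [IsLocalRing R]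
    (h : IsCohenMacaulayLocal R) (p : Ideal R[X]) [p.IsPrime] (hp : p.comap C = maximalIdeal R) :
    IsCohenMacaulayLocal (Localization.AtPrime p) := by
  obtain ⟨n, hn⟩ := h.exists_ringKrullDim_eq
  have hN := h.1
  induction n using Nat.strong_induction_on generalizing R with
  | _ n ih =>
  have hNp := IsLocalization.isNoetherianRing p.primeCompl (Localization.AtPrime p) inferInstance
  by_cases hzero : ringKrullDim R = 0
  · have h0 : Ring.KrullDimLE 0 R := Ring.krullDimLE_iff.mpr (by simp [hzero])
    have hle : ∀ Q : Ideal R[X], Q.IsPrime → (maximalIdeal R).map C ≤ Q := fun Q hQ => by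
      rw [Ideal.map_le_iff_le_comap,
        Ring.KrullDimLE.eq_maximalIdeal_of_isPrime (Q.comap C)]
    -- Over a zero-dimensional base every prime of `R[X]` contains `m[X]`. So `p` is either `m[X]`,
    -- of height zero, or `m[X] + (y)` with `y` monic, of height at most one and containing the
    -- regular element `y`.
    by_cases heq : p = (maximalIdeal R).map C
    · apply of_ringKrullDim_eq_zero
      have hmin : p ∈ minimalPrimes R[X] :=
        ⟨⟨‹_›, bot_le⟩, fun Q ⟨hQ, _⟩ _ => heq.le.trans (hle Q hQ)⟩
      rw [IsLocalization.AtPrime.ringKrullDim_eq_height p, Ideal.height_eq_zero_iff.mpr hmin]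
      rfl
    · obtain ⟨y, hy, hpy⟩ := Polynomial.exists_monic_span_sup_map_eq R p
        (by rw [hp]; infer_instance) (by rwa [hp])
      rw [hp] at hpy
      have hyp : y ∈ p := hpy ▸ Ideal.mem_sup_right (Ideal.mem_span_singleton_self y)
      have hmin : p ∈ (Ideal.span {y}).minimalPrimes := by
        refine ⟨⟨‹_›, by rwa [Ideal.span_singleton_le_iff_mem]⟩, fun Q ⟨hQ, hyQ⟩ _ => ?_⟩
        rw [hpy]
        exact sup_le (hle Q hQ) hyQ
      have hht : p.height ≤ 1 :=
        Ideal.height_le_one_of_isPrincipal_of_mem_minimalPrimes _ _ hmin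
      have hreg : IsSMulRegular R[X] y :=
        isSMulRegular_iff_right_eq_zero_of_smul.mpr fun q hq => by
          rwa [smul_eq_mul, hy.mul_right_eq_zero_iff] at hq
      have hreg' := hreg.localization p
      have hymem : algebraMap R[X] (Localization.AtPrime p) y ∈ maximalIdeal _ :=
        (IsLocalization.AtPrime.to_map_mem_maximal_iff _ p y).mpr hyp
      refine of_ringKrullDim_le_one ?_ hymem hreg'
      rw [IsLocalization.AtPrime.ringKrullDim_eq_height p]
      exact_mod_cast hht
  · obtain ⟨x, hx, hreg⟩ := h.exists_isSMulRegular hzero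
    have hsurj := Ideal.Quotient.mk_surjective (I := Ideal.span {x})
    have : Nontrivial (R ⧸ Ideal.span {x}) := Ideal.Quotient.nontrivial_iff.mpr fun h => by
      rw [Ideal.span_singleton_eq_top] at h
      exact hx h
    have : IsLocalRing (R ⧸ Ideal.span {x}) := .of_surjective' _ hsurj
    have hQ := h.quotient _ hsurj hx hreg Ideal.mk_ker
    have hd := IsCohenMacaulayLocal.ringKrullDim_add_one _ hsurj hx hreg Ideal.mk_ker
    obtain ⟨m, hm⟩ := hQ.exists_ringKrullDim_eq
    have hker := Polynomial.ker_mapRingHom_eq_span (Ideal.mk_ker (I := Ideal.span {x}))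
    have hsurj' := Polynomial.map_surjective _ hsurj
    rw [← coe_mapRingHom] at hsurj'
    obtain ⟨p, hp', rfl⟩ := exists_isPrime_comap_eq hsurj' p (by
      change RingHom.ker _ ≤ _
      rw [hker, Ideal.span_singleton_le_iff_mem, ← Ideal.mem_comap, hp]
      exact hx)
    refine (isCohenMacaulayLocal_localization_iff_of_regular hsurj' hreg.polynomial_C hker p).mp
      (ih m ?_ hQ p (Polynomial.comap_C_eq_maximalIdeal hsurj hp) hm hQ.1)
    rw [hm, hn] at hd
    norm_cast at hd
    lia

/-- Cohen-Macaulayness descends from the polynomial ring localized at the extension of the maximal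
ideal. -/
theorem IsCohenMacaulayLocal.of_polynomial {R : Type u} [CommRing R] [IsLocalRing R]
    [IsNoetherianRing R] (p : Ideal R[X]) [p.IsPrime] (hp : p = (maximalIdeal R).map C)
    (h : IsCohenMacaulayLocal (Localization.AtPrime p)) : IsCohenMacaulayLocal R := by
  obtain ⟨n, hn⟩ : ∃ n : ℕ, ringKrullDim R = n := by
    obtain ⟨d, hd⟩ := WithBot.ne_bot_iff_exists.mp (ringKrullDim_ne_bot (R := R))
    have : d ≠ ⊤ := by
      rintro rfl
      exact ringKrullDim_ne_top hd.symm
    lift d to ℕ using this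
    exact ⟨d, hd.symm⟩
  induction n using Nat.strong_induction_on generalizing R with
  | _ n ih =>
  by_cases hzero : ringKrullDim R = 0
  · exact of_ringKrullDim_eq_zero hzero
  · obtain ⟨y, hy, hyreg⟩ := h.exists_isSMulRegular (by
      rw [IsLocalization.AtPrime.ringKrullDim_eq_height p, hp, Polynomial.height_map_C,
        maximalIdeal_height_eq_ringKrullDim]
      exact hzero)
    -- Otherwise some `z ≠ 0` is killed by the maximal ideal, hence by all of `p`, in particular by
    -- the regular `y`. Then `s * C z = 0` for some `s ∉ p`; a coefficient of `s` is a unit, forcing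
    -- `z = 0`.
    obtain ⟨x, hx, hreg⟩ : ∃ x ∈ maximalIdeal R, IsSMulRegular R x := by
      by_contra! hcon
      obtain ⟨Q, hQ, hmQ⟩ := exists_associatedPrime_of_forall_not_isSMulRegular _ hcon
      obtain ⟨hQp, z, hz⟩ := isAssociatedPrime_iff.mp hQ
      have hmz : ∀ a ∈ maximalIdeal R, a * z = 0 := fun a ha => by
        have := hmQ ha
        rwa [hz, Submodule.mem_colon_singleton, Submodule.mem_bot] at this
      have hpz : p ≤ LinearMap.ker (LinearMap.mulRight R[X] (C z)) := by
        rw [hp, Ideal.map_le_iff_le_comap]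
        intro a ha
        rw [Ideal.mem_comap, LinearMap.mem_ker, LinearMap.mulRight_apply, ← C_mul, hmz a ha, C_0]
      have hyz : y * algebraMap R[X] (Localization.AtPrime p) (C z) = 0 := by
        rw [← Localization.AtPrime.map_eq_maximalIdeal] at hy
        refine Submodule.span_induction ?_ (zero_mul _) (fun a b _ _ ha hb => ?_)
          (fun a b _ hb => ?_) hy
        · rintro _ ⟨f, hf, rfl⟩
          rw [← map_mul]
          exact (congrArg _ (hpz hf)).trans (map_zero _)
        · rw [add_mul, ha, hb, add_zero]
        · rw [smul_mul_assoc, hb, smul_zero]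
      obtain ⟨⟨s, hs⟩, hsz⟩ := (IsLocalization.map_eq_zero_iff p.primeCompl _ _).mp
        (hyreg.right_eq_zero_of_smul hyz)
      apply hs
      rw [hp, SetLike.mem_coe, Ideal.mem_map_C_iff]
      intro i
      by_contra hi
      have hu : IsUnit (s.coeff i) := by simpa using hi
      have hiz : s.coeff i * z = 0 := by
        have := congrArg (fun f => f.coeff i) hsz
        simpa using this
      have hz0 : z = 0 := hu.mul_right_eq_zero.mp hiz
      exact hQp.ne_top (hz.trans (by simp [hz0]))
    have hsurj := Ideal.Quotient.mk_surjective (I := Ideal.span {x})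
    have : Nontrivial (R ⧸ Ideal.span {x}) := Ideal.Quotient.nontrivial_iff.mpr fun h => by
      rw [Ideal.span_singleton_eq_top] at h
      exact hx h
    have : IsLocalRing (R ⧸ Ideal.span {x}) := .of_surjective' _ hsurj
    have hd := IsCohenMacaulayLocal.ringKrullDim_add_one _ hsurj hx hreg Ideal.mk_ker
    have hker := Polynomial.ker_mapRingHom_eq_span (Ideal.mk_ker (I := Ideal.span {x}))
    have hsurj' := Polynomial.map_surjective _ hsurj
    rw [← coe_mapRingHom] at hsurj'
    have hkerp : RingHom.ker (mapRingHom (Ideal.Quotient.mk (Ideal.span {x}))) ≤ p := by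
      rw [hker, Ideal.span_singleton_le_iff_mem, hp]
      exact Ideal.mem_map_of_mem C hx
    obtain ⟨p', hp', rfl⟩ := exists_isPrime_comap_eq hsurj' p hkerp
    obtain ⟨d, hd'⟩ := WithBot.ne_bot_iff_exists.mp
      (ringKrullDim_ne_bot (R := R ⧸ Ideal.span {x}))
    have hd'' : d ≠ ⊤ := by
      rintro rfl
      exact ringKrullDim_ne_top hd'.symm
    lift d to ℕ using hd''
    refine (ih d ?_ p' ?_ ((isCohenMacaulayLocal_localization_iff_of_regular hsurj'
      hreg.polynomial_C hker p').mpr h) hd'.symm).of_quotient _ hsurj hx hreg Ideal.mk_ker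
    · rw [← hd', hn] at hd
      norm_cast at hd
      lia
    · have h1 := congrArg (Ideal.map (mapRingHom (Ideal.Quotient.mk (Ideal.span {x})))) hp
      rw [Ideal.map_comap_of_surjective _ hsurj', Ideal.map_map] at h1
      rw [h1]
      have h2 : (mapRingHom (Ideal.Quotient.mk (Ideal.span {x}))).comp C =
          C.comp (Ideal.Quotient.mk (Ideal.span {x})) := by
        ext r
        simp
      rw [h2, ← Ideal.map_map]
      rw [IsLocalRing.map_maximalIdeal_of_surjective _ hsurj]

/-- A local ring of `R[X]` is a local ring of the polynomial ring over a local ring of `R`. -/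
theorem Polynomial.exists_localization_equiv {R : Type u} [CommRing R] (p : Ideal R[X])
    [p.IsPrime] (q : Ideal R) [q.IsPrime] (hpq : p.comap C = q) :
    ∃ (p' : Ideal (Localization.AtPrime q)[X]) (_ : p'.IsPrime),
      p'.comap C = maximalIdeal (Localization.AtPrime q) ∧
      (p = q.map C → p' = (maximalIdeal (Localization.AtPrime q)).map C) ∧
      Nonempty (Localization.AtPrime p' ≃+* Localization.AtPrime p) := by
  subst hpq
  let q := p.comap C
  let S := (Localization.AtPrime q)[X]
  let pc := Submonoid.map Polynomial.C.toMonoidHom q.primeCompl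
  let : Algebra R[X] S := algebra R (Localization.AtPrime q)
  have : IsLocalization pc S := Polynomial.isLocalization _ _
  let pS := p.map (algebraMap R[X] S)
  have disj : Disjoint (pc : Set R[X]) (p : Set R[X]) := by
    simpa [pc, q] using! Set.disjoint_image_left.mpr
      (Set.disjoint_compl_left_iff_subset.mpr (fun _ a ↦ a))
  have hprime : pS.IsPrime := IsLocalization.isPrime_of_isPrime_disjoint pc _ _ ‹_› disj
  have : IsLocalization.AtPrime (Localization.AtPrime pS) p := by
    convert IsLocalization.isLocalization_isLocalization_atPrime_isLocalization pc
      (Localization.AtPrime pS) pS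
    exact (IsLocalization.under_map_of_isPrime_disjoint pc _ ‹_› disj).symm
  have eq : Ideal.comap C pS = maximalIdeal (Localization.AtPrime q) := by
    rw [← IsLocalization.map_under q.primeCompl _ (Ideal.comap C pS),
      ← IsLocalization.map_under q.primeCompl _ (maximalIdeal (Localization.AtPrime q))]
    simp only [Ideal.comap_comap, S, pS]
    rw [← Polynomial.algebraMap_eq (R := Localization.AtPrime q),
      ← IsScalarTower.algebraMap_eq R (Localization.AtPrime q) (Localization.AtPrime q)[X],
      IsScalarTower.algebraMap_eq R R[X] (Localization.AtPrime q)[X], ← Ideal.comap_comap,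
      ← Ideal.under_def R[X], IsLocalization.under_map_of_isPrime_disjoint pc _ ‹_› disj]
    simp [q, IsLocalization.AtPrime.under_maximalIdeal (Localization.AtPrime q) q]
  refine ⟨pS, hprime, eq, fun hp => ?_, ⟨(IsLocalization.algEquiv p.primeCompl
    (Localization.AtPrime pS) (Localization.AtPrime p)).toRingEquiv⟩⟩
  rw [← Localization.AtPrime.map_eq_maximalIdeal, Ideal.map_map]
  change p.map (algebraMap R[X] S) = _
  conv_lhs => rw [hp]
  rw [Ideal.map_map]
  congr 1
  exact RingHom.ext fun r => Polynomial.map_C _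

theorem IsCohenMacaulayLocal.of_localization_polynomial {R : Type u} [CommRing R]
    [IsNoetherianRing R] (q : Ideal R) [q.IsPrime]
    (h : IsCohenMacaulayLocal (Localization.AtPrime (q.map C : Ideal R[X]))) :
    IsCohenMacaulayLocal (Localization.AtPrime q) := by
  have hcomap : (q.map C : Ideal R[X]).comap C = q := by
    ext x
    rw [Ideal.mem_comap, Ideal.mem_map_C_iff]
    refine ⟨fun h => by simpa using h 0, fun hx n => ?_⟩
    rw [coeff_C]
    split_ifs
    exacts [hx, q.zero_mem]
  obtain ⟨p', hp', -, hmap, ⟨e⟩⟩ := Polynomial.exists_localization_equiv (q.map C) q hcomap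
  have := IsLocalization.isNoetherianRing q.primeCompl (Localization.AtPrime q) inferInstance
  exact (h.of_ringEquiv e.symm).of_polynomial p' (hmap rfl)

/-- A polynomial ring over a Cohen-Macaulay ring is Cohen-Macaulay. -/
theorem IsCohenMacaulayRing.polynomial {R : Type u} [CommRing R] (h : IsCohenMacaulayRing R) :
    IsCohenMacaulayRing R[X] := by
  have := h.1
  refine ⟨inferInstance, fun p hp => ?_⟩
  obtain ⟨p', hp', hcomap, -, ⟨e⟩⟩ := Polynomial.exists_localization_equiv p (p.comap C) rfl
  exact ((h.2 (p.comap C)).polynomial p' hcomap).of_ringEquiv e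

end LocalRings

/-! ### Monomial ideals: covers, height and unmixedness. -/

section MonomialQuotients

open RingTheory.Sequence IsLocalRing

theorem ringKrullDim_le_of_isLocalization {R : Type u} {S : Type v} [CommRing R] [CommRing S]
    [Algebra R S] (M : Submonoid R) [IsLocalization M S] : ringKrullDim S ≤ ringKrullDim R :=
  Order.krullDim_le_of_strictMono (PrimeSpectrum.comap (algebraMap R S))
    (Monotone.strictMono_of_injective (fun _ _ h => Ideal.comap_mono h)
      (PrimeSpectrum.localization_comap_injective S M))

/-- Unmixedness: a minimal prime below a prime `m` at which the ring is Cohen-Macaulay. -/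
theorem IsCohenMacaulayLocal.height_le_ringKrullDim_quotient {R : Type u} [CommRing R]
    {m : Ideal R} [m.IsPrime] (h : IsCohenMacaulayLocal (Localization.AtPrime m))
    {p : Ideal R} (hp : p ∈ minimalPrimes R) (hpm : p ≤ m) :
    (m.height : WithBot ℕ∞) ≤ ringKrullDim (R ⧸ p) := by
  have := hp.1.1
  have hN := h.1
  have hdisj : Disjoint (m.primeCompl : Set R) (p : Set R) :=
    Set.disjoint_left.mpr fun x hx hxp => hx (hpm hxp)
  have hprime := IsLocalization.isPrime_of_isPrime_disjoint m.primeCompl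
    (Localization.AtPrime m) p ‹_› hdisj
  have hmin : p.map (algebraMap R (Localization.AtPrime m)) ∈
      minimalPrimes (Localization.AtPrime m) := by
    rw [← Ideal.height_eq_zero_iff, IsLocalization.height_map_of_disjoint m.primeCompl p hdisj,
      Ideal.height_eq_zero_iff]
    exact hp
  have hass : p.map (algebraMap R (Localization.AtPrime m)) ∈
      associatedPrimes (Localization.AtPrime m) (Localization.AtPrime m) := by
    apply Module.associatedPrimes.minimalPrimes_annihilator_subset_associatedPrimes
    rwa [Module.annihilator_eq_bot.mpr inferInstance]
  rw [← IsLocalization.AtPrime.ringKrullDim_eq_height m (Localization.AtPrime m)]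
  exact (h.le_ringKrullDim_quotient hass).trans
    (ringKrullDim_le_of_isLocalization (Algebra.algebraMapSubmonoid (R ⧸ p) m.primeCompl))

open MvPolynomial

section Monomial

variable (k : Type u) [Field k] {σ : Type} {ι : Type*}

/-- The ideal generated by a family of monomials. -/
noncomputable def monomialIdeal (a : ι → σ →₀ ℕ) : Ideal (MvPolynomial σ k) :=
  Ideal.span (Set.range fun i => monomial (a i) (1 : k))

/-- The ideal generated by a set of variables. -/
noncomputable def variableIdeal (C : Finset σ) : Ideal (MvPolynomial σ k) :=
  Ideal.span (X '' (C : Set σ))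

/-- A set of variables which meets the support of every monomial of a family. -/
def IsMonomialCover (a : ι → σ →₀ ℕ) (C : Finset σ) : Prop := ∀ i, ∃ j ∈ C, a i j ≠ 0

variable {k}

theorem mem_monomialIdeal {a : ι → σ →₀ ℕ} {p : MvPolynomial σ k} :
    p ∈ monomialIdeal k a ↔ ∀ m ∈ p.support, ∃ i, a i ≤ m := by
  have := mem_ideal_span_monomial_image (x := p) (s := Set.range a)
  rw [← Set.range_comp] at this
  exact this.trans (by simp)

theorem X_mem_variableIdeal {C : Finset σ} {j : σ} :
    (X j : MvPolynomial σ k) ∈ variableIdeal k C ↔ j ∈ C := by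
  classical
  rw [variableIdeal, mem_ideal_span_X_image, support_X]
  simp [Finsupp.single_apply]

theorem variableIdeal_le_iff {C : Finset σ} {I : Ideal (MvPolynomial σ k)} :
    variableIdeal k C ≤ I ↔ ∀ j ∈ C, X j ∈ I := by
  rw [variableIdeal, Ideal.span_le, Set.image_subset_iff]
  rfl

theorem variableIdeal_mono {C D : Finset σ} (h : C ⊆ D) : variableIdeal k C ≤ variableIdeal k D :=
  variableIdeal_le_iff.mpr fun _ hj => X_mem_variableIdeal.mpr (h hj)

/-- A prime containing a monomial contains one of its variables. -/
theorem isMonomialCover_of_le {a : ι → σ →₀ ℕ} {P : Ideal (MvPolynomial σ k)} [P.IsPrime]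
    (h : monomialIdeal k a ≤ P) {C : Finset σ} (hC : ∀ j, X j ∈ P → j ∈ C) :
    IsMonomialCover a C := by
  intro i
  have hi : monomial (a i) (1 : k) ∈ P := h (Ideal.subset_span ⟨i, rfl⟩)
  rw [monomial_eq, C_1, one_mul, Finsupp.prod, Ideal.IsPrime.prod_mem_iff] at hi
  obtain ⟨j, hj, hjP⟩ := hi
  exact ⟨j, hC j (Ideal.IsPrime.mem_of_pow_mem ‹_› _ hjP), by simpa using hj⟩

theorem monomialIdeal_le_variableIdeal {a : ι → σ →₀ ℕ} {C : Finset σ} :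
    monomialIdeal k a ≤ variableIdeal k C ↔ IsMonomialCover a C := by
  classical
  rw [monomialIdeal, Ideal.span_le, Set.range_subset_iff]
  refine forall_congr' fun i => ?_
  rw [SetLike.mem_coe, variableIdeal, mem_ideal_span_X_image, support_monomial]
  simp

instance variableIdeal_isPrime (C : Finset σ) : (variableIdeal k C).IsPrime := by
  classical
  let φ : MvPolynomial σ k →ₐ[k] MvPolynomial σ k := aeval fun j => if j ∈ C then 0 else X j
  -- Killing the variables in `C` changes nothing modulo their ideal; so the ideal is the kernel of
  -- a map to a domain.
  have hφ : (Ideal.Quotient.mkₐ k (variableIdeal k C)).comp φ =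
      Ideal.Quotient.mkₐ k (variableIdeal k C) := by
    ext j
    simp only [AlgHom.comp_apply, φ, aeval_X]
    split_ifs with hj
    · rw [map_zero, eq_comm, Ideal.Quotient.mkₐ_eq_mk, Ideal.Quotient.eq_zero_iff_mem]
      exact X_mem_variableIdeal.mpr hj
    · rfl
  have hker : RingHom.ker φ = variableIdeal k C := by
    apply le_antisymm
    · intro p hp
      have := congrArg (fun f => f p) hφ
      rw [RingHom.mem_ker] at hp
      simp only [AlgHom.comp_apply, hp, map_zero] at this
      exact Ideal.Quotient.eq_zero_iff_mem.mp this.symm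
    · rw [variableIdeal_le_iff]
      intro j hj
      simp [φ, RingHom.mem_ker, hj]
  rw [← hker]
  exact RingHom.ker_isPrime _

theorem variableIdeal_lt_insert [DecidableEq σ] {C : Finset σ} {j : σ} (hj : j ∉ C) :
    variableIdeal k C < variableIdeal k (insert j C) :=
  lt_of_le_of_ne (variableIdeal_mono (Finset.subset_insert j C)) fun h => hj <|
    X_mem_variableIdeal.mp (h ▸ X_mem_variableIdeal.mpr (Finset.mem_insert_self j C))

variable [Finite σ]

/-- Krull's height theorem bounds it above; adjoining the variables one at a time gives a strict
chain of primes below. -/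
theorem height_variableIdeal (C : Finset σ) : (variableIdeal k C).height = C.card := by
  classical
  apply le_antisymm
  · have : (variableIdeal k C).height ≤ (C.image (X : σ → MvPolynomial σ k)).card := by
      apply Ideal.height_le_card_of_mem_minimalPrimes_span_finset
      rw [Finset.coe_image, ← variableIdeal, Ideal.minimalPrimes_eq_subsingleton_self]
      rfl
    exact this.trans (by exact_mod_cast Finset.card_image_le)
  · induction C using Finset.induction_on with
    | empty => simp
    | insert j C hj ih =>
      rw [Finset.card_insert_of_notMem hj]
      push_cast
      exact (by gcongr : _ ≤ (variableIdeal k C).height + 1).trans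
        (Ideal.height_add_one_le_of_lt_of_isPrime (variableIdeal_lt_insert hj))

theorem ringKrullDim_quotient_variableIdeal_add_card (C : Finset σ) :
    ringKrullDim (MvPolynomial σ k ⧸ variableIdeal k C) + C.card ≤ Nat.card σ := by
  classical
  induction C using Finset.induction_on with
  | empty =>
    refine (add_zero _).le.trans ((ringKrullDim_quotient_le _).trans ?_)
    rw [MvPolynomial.ringKrullDim_of_isNoetherianRing, ringKrullDim_eq_zero_of_field, zero_add]
  | insert j C hj ih =>
    rw [Finset.card_insert_of_notMem hj]
    push_cast
    rw [add_comm (C.card : WithBot ℕ∞) 1, ← add_assoc]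
    refine le_trans ?_ ih
    gcongr
    exact ringKrullDim_quotient_add_one_le (variableIdeal_lt_insert hj)

/-- The variables lying in a prime over the ideal form a cover, and they generate a smaller prime
still containing the ideal. Thus the height is the least size of a cover. -/
theorem height_monomialIdeal_eq_iff {a : ι → σ →₀ ℕ} {c : ℕ} :
    (monomialIdeal k a).height = c ↔
      (∃ C, IsMonomialCover a C ∧ C.card = c) ∧ ∀ C, IsMonomialCover a C → c ≤ C.card := by
  classical
  have hle : ∀ C, IsMonomialCover a C → (monomialIdeal k a).height ≤ C.card := fun C hC => by
    rw [← height_variableIdeal (k := k)]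
    exact Ideal.height_mono (monomialIdeal_le_variableIdeal.mpr hC)
  have hge : ∀ P : Ideal (MvPolynomial σ k), P.IsPrime → monomialIdeal k a ≤ P →
      ∃ C, IsMonomialCover a C ∧ (C.card : ℕ∞) ≤ P.height := fun P hP hle => by
    have := Fintype.ofFinite σ
    refine ⟨Finset.univ.filter fun j => X j ∈ P, isMonomialCover_of_le hle (by simp), ?_⟩
    rw [← height_variableIdeal (k := k)]
    exact Ideal.height_mono (variableIdeal_le_iff.mpr (by simp))
  constructor
  · intro h
    have hmin : ∀ C, IsMonomialCover a C → c ≤ C.card := fun C hC => by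
      have := hle C hC
      rw [h] at this
      exact_mod_cast this
    refine ⟨?_, hmin⟩
    obtain ⟨P, hP, hle', hPc⟩ := Ideal.exists_isPrime_height_eq h
    obtain ⟨C, hC, hCP⟩ := hge P hP hle'
    rw [hPc] at hCP
    exact ⟨C, hC, le_antisymm (by exact_mod_cast hCP) (hmin C hC)⟩
  · rintro ⟨⟨C, hC, rfl⟩, hmin⟩
    refine le_antisymm (hle C hC) ?_
    rw [Ideal.height_eq_inf_minimalPrimes]
    refine le_iInf₂ fun P hP => ?_
    obtain ⟨D, hD, hDP⟩ := hge P hP.1.1 hP.1.2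
    exact le_trans (by exact_mod_cast hmin D hD) hDP

/-- If a monomial ideal has a Cohen-Macaulay quotient at the origin, all its minimal covers have the
same cardinality. -/
theorem card_le_card_of_minimal_cover {a : ι → σ →₀ ℕ}
    {m : Ideal (MvPolynomial σ k ⧸ monomialIdeal k a)} [m.IsPrime]
    (hm : ∀ j, Ideal.Quotient.mk _ (X j) ∈ m)
    (h : IsCohenMacaulayLocal (Localization.AtPrime m)) {C D : Finset σ}
    (hC : Minimal (IsMonomialCover a) C) (hD : IsMonomialCover a D) : C.card ≤ D.card := by
  classical
  have := Fintype.ofFinite σ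
  have hsurj := Ideal.Quotient.mk_surjective (I := monomialIdeal k a)
  have hprime : ∀ E, D ⊆ E → ((variableIdeal k E).map
      (Ideal.Quotient.mk (monomialIdeal k a))).IsPrime := fun E hE =>
    Ideal.map_isPrime_of_surjective hsurj (by
      rw [Ideal.mk_ker]
      exact (monomialIdeal_le_variableIdeal.mpr hD).trans (variableIdeal_mono hE))
  have hcomap : ∀ E, monomialIdeal k a ≤ variableIdeal k E → ((variableIdeal k E).map
      (Ideal.Quotient.mk (monomialIdeal k a))).comap (Ideal.Quotient.mk (monomialIdeal k a)) =
      variableIdeal k E := fun E hE => by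
    rw [Ideal.comap_map_of_surjective _ hsurj, sup_eq_left]
    exact (Ideal.mk_ker (I := monomialIdeal k a)).le.trans hE
  have hmap : ∀ E, (variableIdeal k E).map (Ideal.Quotient.mk (monomialIdeal k a)) ≤ m := fun E => by
    rw [Ideal.map_le_iff_le_comap, variableIdeal_le_iff]
    exact fun j _ => hm j
  -- Adding variables outside the cover `D` one by one gives a chain of primes below `m`, so `m` has
  -- height at least the size of the complement of `D`.
  have hlow : ∀ F : Finset σ, Disjoint F D → (F.card : ℕ∞) ≤ ((variableIdeal k (F ∪ D)).map
      (Ideal.Quotient.mk (monomialIdeal k a))).height := by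
    intro F
    induction F using Finset.induction_on with
    | empty => simp
    | insert j F hj ih =>
      intro hdisj
      rw [Finset.disjoint_insert_left] at hdisj
      have := hprime (F ∪ D) Finset.subset_union_right
      have := hprime (insert j F ∪ D) Finset.subset_union_right
      rw [Finset.card_insert_of_notMem hj]
      push_cast
      refine le_trans (add_le_add_left (ih hdisj.2) 1)
        (Ideal.height_add_one_le_of_lt_of_isPrime (lt_of_le_of_ne (Ideal.map_mono
          (variableIdeal_mono (Finset.union_subset_union_left (Finset.subset_insert j F))))
          fun heq => ?_))
      have hI : ∀ E, D ⊆ E → monomialIdeal k a ≤ variableIdeal k E := fun E hE =>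
        (monomialIdeal_le_variableIdeal.mpr hD).trans (variableIdeal_mono hE)
      have h2 := congrArg (Ideal.comap (Ideal.Quotient.mk (monomialIdeal k a))) heq
      rw [hcomap _ (hI _ Finset.subset_union_right), hcomap _ (hI _ Finset.subset_union_right)] at h2
      have h3 : j ∈ F ∪ D := (X_mem_variableIdeal (k := k) (j := j)).mp (by
        rw [h2, X_mem_variableIdeal]
        simp)
      rw [Finset.mem_union] at h3
      exact h3.elim hj hdisj.1
  have hlow' : ((Dᶜ.card : ℕ∞) : WithBot ℕ∞) ≤ m.height := by
    have := hprime (Dᶜ ∪ D) Finset.subset_union_right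
    exact_mod_cast (hlow Dᶜ disjoint_compl_left).trans (Ideal.height_mono (hmap _))
  have hCI := monomialIdeal_le_variableIdeal (k := k).mpr hC.1
  obtain ⟨p, hp, hpC⟩ := exists_isPrime_comap_eq hsurj (variableIdeal k C)
    (by change RingHom.ker _ ≤ _; rwa [Ideal.mk_ker])
  have hpmap : p = (variableIdeal k C).map (Ideal.Quotient.mk (monomialIdeal k a)) := by
    rw [hpC, Ideal.map_comap_of_surjective _ hsurj]
  -- Minimality of the cover `C` makes its variable ideal a minimal prime, to which unmixedness
  -- applies.
  have hmin : p ∈ minimalPrimes (MvPolynomial σ k ⧸ monomialIdeal k a) := by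
    refine ⟨⟨hp, bot_le⟩, fun Q ⟨hQ, _⟩ hQp => ?_⟩
    rw [hpmap, Ideal.map_le_iff_le_comap, variableIdeal_le_iff]
    have hQI : monomialIdeal k a ≤ Q.comap (Ideal.Quotient.mk (monomialIdeal k a)) := by
      rw [← Ideal.map_le_iff_le_comap, Ideal.map_quotient_self]
      exact bot_le
    have hcov := isMonomialCover_of_le hQI (C := Finset.univ.filter
      fun j => X j ∈ Q.comap (Ideal.Quotient.mk (monomialIdeal k a))) (by simp)
    intro j hj
    have := hC.2 hcov (fun l hl => by
      have : X l ∈ p.comap (Ideal.Quotient.mk (monomialIdeal k a)) := hQp (by simpa using hl)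
      rwa [← hpC, X_mem_variableIdeal] at this) hj
    simpa using this
  have hup := h.height_le_ringKrullDim_quotient hmin (hpmap.le.trans (hmap C))
  have hq : ringKrullDim ((MvPolynomial σ k ⧸ monomialIdeal k a) ⧸ p) ≤
      ringKrullDim (MvPolynomial σ k ⧸ variableIdeal k C) := by
    refine ringKrullDim_le_of_surjective (Ideal.Quotient.lift _
      ((Ideal.Quotient.mk p).comp (Ideal.Quotient.mk (monomialIdeal k a))) ?_)
      (Ideal.Quotient.lift_surjective_of_surjective _ _
        (Ideal.Quotient.mk_surjective.comp hsurj))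
    intro x hx
    rw [hpC] at hx
    exact Ideal.Quotient.eq_zero_iff_mem.mpr hx
  -- With `s` variables in total: `s - |D| ≤ height m ≤ dim` of the quotient by `C`, which is at
  -- most `s - |C|`.
  have hfin := (add_le_add_left (hlow'.trans (hup.trans hq)) (C.card : WithBot ℕ∞)).trans
    (ringKrullDim_quotient_variableIdeal_add_card C)
  rw [Nat.card_eq_fintype_card] at hfin
  norm_cast at hfin
  have := Finset.card_compl_add_card D
  lia

end Monomial

/-! ### The prime generated by all variables. -/

section Origin

variable {k : Type u} [Field k] {σ : Type} {ι : Type*} {a : ι → σ →₀ ℕ}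

theorem mk_sub_C_constantCoeff_mem {P : Ideal (MvPolynomial σ k ⧸ monomialIdeal k a)}
    (hP : ∀ j, Ideal.Quotient.mk _ (X j) ∈ P) (p : MvPolynomial σ k) :
    Ideal.Quotient.mk _ (p - C (constantCoeff p)) ∈ P := by
  have hle : Ideal.span (Set.range (X : σ → MvPolynomial σ k)) ≤
      P.comap (Ideal.Quotient.mk (monomialIdeal k a)) := by
    rw [Ideal.span_le, Set.range_subset_iff]
    exact hP
  apply hle
  rw [← Set.image_univ, mem_ideal_span_X_image]
  intro m hm
  by_contra! hcon
  have hm0 : m = 0 := Finsupp.ext fun i => by simpa using hcon i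
  subst hm0
  simp [constantCoeff_eq] at hm

theorem mk_mem_origin_iff {P : Ideal (MvPolynomial σ k ⧸ monomialIdeal k a)} [P.IsPrime]
    (hP : ∀ j, Ideal.Quotient.mk _ (X j) ∈ P) (p : MvPolynomial σ k) :
    Ideal.Quotient.mk _ p ∈ P ↔ constantCoeff p = 0 := by
  have h := mk_sub_C_constantCoeff_mem hP p
  rw [map_sub] at h
  rw [← Ideal.add_mem_iff_left P (neg_mem h)]
  simp only [neg_sub, add_sub_cancel]
  constructor
  · intro hc
    by_contra hne
    refine Ideal.IsPrime.ne_top' (Ideal.eq_top_of_isUnit_mem P hc ?_)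
    exact ((isUnit_iff_ne_zero.mpr hne).map (C : k →+* MvPolynomial σ k)).map _
  · intro hc
    rw [hc]
    simp

theorem origin_unique {P Q : Ideal (MvPolynomial σ k ⧸ monomialIdeal k a)} [P.IsPrime] [Q.IsPrime]
    (hP : ∀ j, Ideal.Quotient.mk _ (X j) ∈ P) (hQ : ∀ j, Ideal.Quotient.mk _ (X j) ∈ Q) :
    P = Q := by
  ext x
  obtain ⟨p, rfl⟩ := Ideal.Quotient.mk_surjective x
  rw [mk_mem_origin_iff hP, mk_mem_origin_iff hQ]

theorem monomialIdeal_ne_top_iff : monomialIdeal k a ≠ ⊤ ↔ ∀ i, a i ≠ 0 := by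
  classical
  rw [Ne, Ideal.eq_top_iff_one, mem_monomialIdeal]
  simp [support_one]

variable (k a) in
theorem exists_origin (h : ∀ i, a i ≠ 0) :
    ∃ P : Ideal (MvPolynomial σ k ⧸ monomialIdeal k a), P.IsPrime ∧
      ∀ j, Ideal.Quotient.mk _ (X j) ∈ P := by
  have hle : monomialIdeal k a ≤ RingHom.ker (constantCoeff (σ := σ) (R := k)) := by
    rw [monomialIdeal, Ideal.span_le, Set.range_subset_iff]
    intro i
    classical
    simp [RingHom.mem_ker, constantCoeff_monomial, h i]
  have := RingHom.ker_isPrime (constantCoeff (σ := σ) (R := k))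
  obtain ⟨P, hP, hPc⟩ := exists_isPrime_comap_eq (Ideal.Quotient.mk_surjective
    (I := monomialIdeal k a)) (RingHom.ker (constantCoeff (σ := σ) (R := k)))
    (by change RingHom.ker _ ≤ _; rwa [Ideal.mk_ker])
  refine ⟨P, hP, fun j => ?_⟩
  rw [← Ideal.mem_comap, ← hPc]
  simp [RingHom.mem_ker]

end Origin

/-! ### Setting a variable equal to one. -/

section Restrict

variable (k : Type u) [Field k] {σ : Type} {ι : Type*} (a : ι → σ →₀ ℕ) (j : σ)

/-- The family of monomials obtained by setting the variable `j` equal to `1`. -/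
noncomputable def restrictVar (i : ι) : {l // l ≠ j} →₀ ℕ := (a i).subtypeDomain (· ≠ j)

open Classical in
/-- A polynomial ring as a polynomial ring in the variable `j` over the other variables. -/
noncomputable def splitVar : MvPolynomial σ k ≃ₐ[k] Polynomial (MvPolynomial {l // l ≠ j} k) :=
  (renameEquiv k (Equiv.optionSubtypeNe j).symm).trans (optionEquivLeft k {l // l ≠ j})

variable {k j} in
theorem coeff_coeff_splitVar (p : MvPolynomial σ k) (m : σ →₀ ℕ) :
    coeff (m.subtypeDomain (· ≠ j)) ((splitVar k j p).coeff (m j)) = coeff m p := by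
  classical
  have hm : Finsupp.optionElim (m j) (m.subtypeDomain (· ≠ j)) =
      m.mapDomain (Equiv.optionSubtypeNe j).symm := by
    ext l
    rw [Finsupp.mapDomain_equiv_apply]
    cases l <;> simp
  rw [splitVar, AlgEquiv.trans_apply, optionEquivLeft_coeff_coeff, hm, renameEquiv_apply]
  exact coeff_rename_mapDomain _ (Equiv.injective _) _ _

theorem splitVar_X_self : splitVar k j (X j) = Polynomial.X := by
  classical
  simp [splitVar]

/-- Comparison of a monomial quotient with the polynomial ring over its restriction. -/
noncomputable def splitVarQuot : MvPolynomial σ k →+*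
    Polynomial (MvPolynomial {l // l ≠ j} k ⧸ monomialIdeal k (restrictVar a j)) :=
  (Polynomial.mapRingHom (Ideal.Quotient.mk _)).comp (splitVar k j : _ →+* _)

theorem splitVarQuot_surjective : Function.Surjective (splitVarQuot k a j) := by
  rw [splitVarQuot, RingHom.coe_comp, Polynomial.coe_mapRingHom]
  exact (Polynomial.map_surjective _ Ideal.Quotient.mk_surjective).comp (splitVar k j).surjective

variable {k} in
theorem splitVarQuot_eq_zero_iff {p : MvPolynomial σ k} : splitVarQuot k a j p = 0 ↔
    ∀ m ∈ p.support, ∃ i, restrictVar a j i ≤ m.subtypeDomain (· ≠ j) := by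
  classical
  have h0 : splitVarQuot k a j p = 0 ↔
      ∀ n, (splitVar k j p).coeff n ∈ monomialIdeal k (restrictVar a j) := by
    rw [Polynomial.ext_iff]
    refine forall_congr' fun n => ?_
    rw [← Ideal.Quotient.eq_zero_iff_mem]
    simp [splitVarQuot]
  rw [h0]
  constructor
  · intro h m hm
    refine mem_monomialIdeal.mp (h (m j)) _ ?_
    rw [mem_support_iff] at hm ⊢
    rwa [coeff_coeff_splitVar]
  · intro h n
    rw [mem_monomialIdeal]
    intro m' hm'
    obtain ⟨m, hm1, hm2⟩ : ∃ m : σ →₀ ℕ, m.subtypeDomain (· ≠ j) = m' ∧ m j = n := by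
      refine ⟨(Finsupp.optionElim n m').mapDomain (Equiv.optionSubtypeNe j), ?_, ?_⟩
      · ext l
        simp [Finsupp.mapDomain_equiv_apply, l.2]
      · simp [Finsupp.mapDomain_equiv_apply]
    subst hm1 hm2
    refine h m ?_
    rw [mem_support_iff] at hm' ⊢
    rwa [coeff_coeff_splitVar] at hm'

theorem splitVarQuot_apply_eq_zero_of_mem {p : MvPolynomial σ k} (hp : p ∈ monomialIdeal k a) :
    splitVarQuot k a j p = 0 := by
  rw [splitVarQuot_eq_zero_iff]
  intro m hm
  obtain ⟨i, hi⟩ := mem_monomialIdeal.mp hp m hm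
  exact ⟨i, fun l => hi l⟩

/-- The induced map on the quotient by the monomial ideal. -/
noncomputable def splitVarHom : MvPolynomial σ k ⧸ monomialIdeal k a →+*
    Polynomial (MvPolynomial {l // l ≠ j} k ⧸ monomialIdeal k (restrictVar a j)) :=
  Ideal.Quotient.lift _ (splitVarQuot k a j)
    fun _ hp => splitVarQuot_apply_eq_zero_of_mem k a j hp

theorem splitVarHom_surjective : Function.Surjective (splitVarHom k a j) :=
  Ideal.Quotient.lift_surjective_of_surjective _ _ (splitVarQuot_surjective k a j)

theorem splitVarHom_X_self : splitVarHom k a j (Ideal.Quotient.mk _ (X j)) = Polynomial.X := by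
  rw [splitVarHom, Ideal.Quotient.lift_mk]
  simp [splitVarQuot, splitVar_X_self]

/-- A high power of `x_j` restores the `j`-exponents that restriction forgets; the sum of these
exponents is a crude common bound. Hence `splitVarHom` is an isomorphism on local rings at primes
avoiding `x_j`. -/
theorem exists_pow_mul_eq_zero_of_splitVarHom [Finite ι] : ∃ N : ℕ, ∀ x, splitVarHom k a j x = 0 →
    Ideal.Quotient.mk _ (X j) ^ N * x = 0 := by
  classical
  have := Fintype.ofFinite ι
  refine ⟨∑ i, a i j, fun x hx => ?_⟩
  obtain ⟨p, rfl⟩ := Ideal.Quotient.mk_surjective x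
  rw [splitVarHom, Ideal.Quotient.lift_mk, splitVarQuot_eq_zero_iff] at hx
  rw [← map_pow, ← map_mul, Ideal.Quotient.eq_zero_iff_mem, mem_monomialIdeal]
  intro m hm
  rw [X_pow_eq_monomial, mem_support_iff, coeff_monomial_mul'] at hm
  split_ifs at hm with hle
  swap
  · simp at hm
  rw [one_mul, ← mem_support_iff] at hm
  obtain ⟨i, hi⟩ := hx _ hm
  refine ⟨i, fun l => ?_⟩
  by_cases hl : l = j
  · subst hl
    refine (Finset.single_le_sum (f := fun i => a i l) (fun _ _ => Nat.zero_le _)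
      (Finset.mem_univ i)).trans ?_
    simpa using hle l
  · have := hi ⟨l, hl⟩
    simp only [restrictVar, Finsupp.subtypeDomain_apply, Finsupp.tsub_apply] at this
    exact this.trans (Nat.sub_le _ _)

end Restrict

/-! ### Reduction of Cohen-Macaulayness to the origin. -/

section Graded

variable {k : Type u} [Field k] {ι : Type*} [Finite ι]

/-- The prime `Q[x_j]` avoids `x_j` and pulls back to a prime inside the origin `P`, so its local
ring is a localization of the one at `P`. Descent from the polynomial ring then reaches `Q`. -/
theorem isCohenMacaulayLocal_restrictVar_origin {σ : Type} [Finite σ] {a : ι → σ →₀ ℕ} (j : σ)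
    {P : Ideal (MvPolynomial σ k ⧸ monomialIdeal k a)} [P.IsPrime]
    (hP : ∀ l, Ideal.Quotient.mk _ (X l) ∈ P)
    (h : IsCohenMacaulayLocal (Localization.AtPrime P))
    {Q : Ideal (MvPolynomial {l // l ≠ j} k ⧸ monomialIdeal k (restrictVar a j))} [Q.IsPrime]
    (hQ : ∀ l, Ideal.Quotient.mk _ (X l) ∈ Q) :
    IsCohenMacaulayLocal (Localization.AtPrime Q) := by
  classical
  apply IsCohenMacaulayLocal.of_localization_polynomial
  rw [isCohenMacaulayLocal_localization_iff_of_ker (splitVarHom_surjective k a j)]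
  · refine h.localization_of_le fun x hx => ?_
    obtain ⟨p, rfl⟩ := Ideal.Quotient.mk_surjective x
    rw [mk_mem_origin_iff hP]
    rw [Ideal.mem_comap, Ideal.mem_map_C_iff] at hx
    have h0 := hx 0
    rw [splitVarHom, Ideal.Quotient.lift_mk, splitVarQuot, RingHom.comp_apply,
      Polynomial.coe_mapRingHom, Polynomial.coeff_map, mk_mem_origin_iff hQ] at h0
    rw [constantCoeff_eq, ← coeff_coeff_splitVar (j := j)]
    exact h0
  · obtain ⟨N, hN⟩ := exists_pow_mul_eq_zero_of_splitVarHom k a j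
    refine fun x hx => ⟨_, ?_, hN x hx⟩
    rw [Ideal.mem_comap, map_pow, splitVarHom_X_self, Ideal.mem_map_C_iff]
    intro hcon
    have := hcon N
    rw [Polynomial.coeff_X_pow_self] at this
    exact Ideal.IsPrime.one_notMem ‹_› this

/-- A monomial quotient ring which is Cohen-Macaulay at the origin is Cohen-Macaulay. -/
theorem isCohenMacaulayRing_of_origin {σ : Type} [Finite σ] {a : ι → σ →₀ ℕ}
    {P : Ideal (MvPolynomial σ k ⧸ monomialIdeal k a)} [P.IsPrime]
    (hP : ∀ l, Ideal.Quotient.mk _ (X l) ∈ P)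
    (h : IsCohenMacaulayLocal (Localization.AtPrime P)) :
    IsCohenMacaulayRing (MvPolynomial σ k ⧸ monomialIdeal k a) := by
  classical
  obtain ⟨n, hn⟩ : ∃ n, Nat.card σ = n := ⟨_, rfl⟩
  induction n using Nat.strong_induction_on generalizing σ with
  | _ n ih =>
  refine ⟨inferInstance, fun R hR => ?_⟩
  by_cases hall : ∀ l, Ideal.Quotient.mk _ (X l) ∈ R
  · obtain rfl := origin_unique hP hall
    exact h
  push Not at hall
  obtain ⟨j, hj⟩ := hall
  obtain ⟨N, hN⟩ := exists_pow_mul_eq_zero_of_splitVarHom k a j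
  have hjN : Ideal.Quotient.mk (monomialIdeal k a) (X j) ^ N ∉ R :=
    fun hjN => hj (hR.mem_of_pow_mem N hjN)
  have hker : ∀ x, splitVarHom k a j x = 0 → x ∈ R := fun x hx => by
    refine (hR.mem_or_mem (?_ : Ideal.Quotient.mk _ (X j) ^ N * x ∈ R)).resolve_left hjN
    rw [hN x hx]
    exact R.zero_mem
  -- A prime avoiding `x_j` comes from the polynomial ring over the restricted quotient, which has
  -- one variable fewer and is covered by induction.
  obtain ⟨R', hR', rfl⟩ := exists_isPrime_comap_eq
    (S := Polynomial (MvPolynomial {l // l ≠ j} k ⧸ monomialIdeal k (_root_.restrictVar a j)))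
    (splitVarHom_surjective k a j) R hker
  refine (isCohenMacaulayLocal_localization_iff_of_ker (splitVarHom_surjective k a j) R'
    fun x hx => ⟨_, hjN, hN x hx⟩).mp ?_
  have hne : ∀ i, restrictVar a j i ≠ 0 := by
    rw [← monomialIdeal_ne_top_iff (k := k), ← Ideal.Quotient.nontrivial_iff]
    by_contra hcon
    rw [not_nontrivial_iff_subsingleton] at hcon
    have := hR'.ne_top
    exact this (Subsingleton.elim _ _)
  obtain ⟨Q, hQp, hQ⟩ := exists_origin k (restrictVar a j) hne
  have hcard : Nat.card {l // l ≠ j} < n := by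
    have := Fintype.ofFinite σ
    rw [← hn, Nat.card_eq_fintype_card, Nat.card_eq_fintype_card]
    exact Fintype.card_subtype_lt (x := j) (by simp)
  exact (ih _ hcard hQ (isCohenMacaulayLocal_restrictVar_origin j hP h hQ) rfl).polynomial.2 R'

theorem IsCohenMacaulayRing.restrictVar {σ : Type} [Finite σ] {a : ι → σ →₀ ℕ} (j : σ)
    (h : IsCohenMacaulayRing (MvPolynomial σ k ⧸ monomialIdeal k a))
    (hne : ∀ i, restrictVar a j i ≠ 0) :
    IsCohenMacaulayRing (MvPolynomial {l // l ≠ j} k ⧸ monomialIdeal k (restrictVar a j)) := by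
  obtain ⟨P, hPp, hP⟩ := exists_origin k a fun i hi => hne i (by simp [_root_.restrictVar, hi])
  obtain ⟨Q, hQp, hQ⟩ := exists_origin k (_root_.restrictVar a j) hne
  exact isCohenMacaulayRing_of_origin hQ
    (isCohenMacaulayLocal_restrictVar_origin j hP (h.2 P) hQ)

end Graded

theorem IsCohenMacaulayRing.of_ringEquiv {R : Type u} {S : Type v} [CommRing R] [CommRing S]
    (e : R ≃+* S) (h : IsCohenMacaulayRing R) : IsCohenMacaulayRing S := by
  have := h.1
  refine ⟨isNoetherianRing_of_ringEquiv R e, fun P hP => ?_⟩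
  refine (isCohenMacaulayLocal_localization_iff_of_ker (f := (e : R →+* S)) e.surjective P
    fun x hx => ⟨1, ?_, ?_⟩).mpr (h.2 _)
  · exact Ideal.one_notMem _
  · rw [one_mul]
    exact e.injective (hx.trans (map_zero e).symm)

/-! ### One step of polarization is a regular lifting. -/

section Polarization

variable (k : Type u) [Field k] {σ : Type} {ι : Type*} (a : ι → σ →₀ ℕ) (j : σ)

/-- One step of polarization: one factor of the variable `j` is replaced by a new variable. -/
noncomputable def polarize (i : ι) : Option σ →₀ ℕ :=
  Finsupp.optionElim (min 1 (a i j)) (a i - Finsupp.single j 1)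

theorem polarize_none (i : ι) : polarize a j i none = min 1 (a i j) := by
  simp [polarize]

theorem polarize_some_self (i : ι) : polarize a j i (some j) = a i j - 1 := by
  simp [polarize]

theorem polarize_some_ne (i : ι) {l : σ} (hl : l ≠ j) : polarize a j i (some l) = a i l := by
  simp [polarize, hl.symm]

/-- The substitution which undoes a step of polarization. -/
def depolarizeVar (o : Option σ) : σ := o.elim j id

theorem mapDomain_polarize (i : ι) : (polarize a j i).mapDomain (depolarizeVar j) = a i := by
  classical
  have hdec : ∀ (y : ℕ) (m : σ →₀ ℕ), Finsupp.optionElim y m =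
      Finsupp.single none y + m.mapDomain some := by
    intro y m
    ext o
    cases o with
    | none =>
      rw [Finsupp.add_apply, Finsupp.mapDomain_of_notMem_range _ _ (by simp)]
      simp
    | some l =>
      rw [Finsupp.add_apply, Finsupp.mapDomain_apply (Option.some_injective σ)]
      simp
  rw [polarize, hdec, Finsupp.mapDomain_add, Finsupp.mapDomain_single, ← Finsupp.mapDomain_comp]
  have : depolarizeVar j ∘ some = id := rfl
  rw [this, Finsupp.mapDomain_id]
  ext l
  by_cases hl : l = j
  · subst hl
    simp [depolarizeVar]
    lia
  · simp [depolarizeVar, Ne.symm hl]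

theorem rename_monomial_polarize (i : ι) : rename (depolarizeVar j) (monomial (polarize a j i) 1) =
    monomial (a i) (1 : k) := by
  rw [rename_monomial, mapDomain_polarize]

variable {a j}

/-- Among the exponents of `p` outside the ideal, take `w` with the largest exponent of the new
variable `y`, and look at where `y * x^w` and `x_j * x^w` can cancel in `(y - x_j) * p`. -/
theorem mem_monomialIdeal_polarize_of_mul_mem {p : MvPolynomial (Option σ) k}
    (h : (X none - X (some j)) * p ∈ monomialIdeal k (polarize a j)) :
    p ∈ monomialIdeal k (polarize a j) := by
  classical
  by_contra hp
  rw [mem_monomialIdeal] at h hp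
  push Not at hp
  obtain ⟨w₀, hw₀, hw₀'⟩ := hp
  obtain ⟨w, hwB, hmax⟩ := Finset.exists_max_image
    (p.support.filter fun w => ∀ i, ¬ polarize a j i ≤ w) (fun w => w none)
    ⟨w₀, by simpa using ⟨by simpa using hw₀, hw₀'⟩⟩
  rw [Finset.mem_filter] at hwB
  obtain ⟨hw, hwI⟩ := hwB
  rw [mem_support_iff] at hw
  -- If `y * x^w` were outside the ideal, it would have to cancel against an exponent outside the
  -- ideal with a larger `y`-part than `w`. So it is inside while `x^w` is not: a generator needs
  -- the extra `y`, and its `y`-exponent is at most one.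
  have hnone : w none = 0 := by
    obtain ⟨l, hl⟩ : ∃ l, polarize a j l ≤ Finsupp.single none 1 + w := by
      by_contra! hcon
      have h0 : coeff (Finsupp.single none 1 + w) ((X none - X (some j)) * p) = 0 := by
        by_contra hne
        obtain ⟨i, hi⟩ := h _ (mem_support_iff.mpr hne)
        exact hcon i hi
      rw [sub_mul, coeff_sub, coeff_X_mul, coeff_X_mul'] at h0
      split_ifs at h0 with hs
      · have hne : coeff (Finsupp.single none 1 + w - Finsupp.single (some j) 1) p ≠ 0 := by
          rw [← sub_eq_zero.mp h0]
          exact hw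
        have := hmax (Finsupp.single none 1 + w - Finsupp.single (some j) 1) (by
          rw [Finset.mem_filter, mem_support_iff]
          exact ⟨hne, fun i hi => hcon i (hi.trans tsub_le_self)⟩)
        simp at this
      · rw [sub_zero] at h0
        exact hw h0
    have hlt : ∃ o, w o < polarize a j l o := by
      by_contra! hcon
      exact hwI l hcon
    obtain ⟨o, ho⟩ := hlt
    have hlo := hl o
    rw [Finsupp.add_apply, Finsupp.single_apply] at hlo
    split_ifs at hlo with hon
    · subst hon
      rw [polarize_none] at ho
      lia
    · lia
  -- Without `y` in `w`, nothing cancels `x_j * x^w`. A generator dividing it is free of `y`, hence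
  -- free of `x_j`, and so already divides `x^w`.
  have hv : coeff (Finsupp.single (some j) 1 + w) ((X none - X (some j)) * p) ≠ 0 := by
    rw [sub_mul, coeff_sub, coeff_X_mul, coeff_X_mul', if_neg (by simp [hnone]), zero_sub]
    exact neg_ne_zero.mpr hw
  obtain ⟨i, hi⟩ := h _ (mem_support_iff.mpr hv)
  have hlt : ∃ o, w o < polarize a j i o := by
    by_contra! hcon
    exact hwI i hcon
  obtain ⟨o, ho⟩ := hlt
  have hio := hi o
  rw [Finsupp.add_apply, Finsupp.single_apply] at hio
  split_ifs at hio with hon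
  · subst hon
    have h1 := hi none
    rw [polarize_some_self] at ho
    rw [polarize_none, Finsupp.add_apply, hnone, Finsupp.single_apply, if_neg (by simp)] at h1
    lia
  · lia

variable (a j)

/-- The quotient map from a step of polarization to the original quotient ring. -/
noncomputable def depolarizeHom : MvPolynomial (Option σ) k ⧸ monomialIdeal k (polarize a j) →+*
    MvPolynomial σ k ⧸ monomialIdeal k a :=
  Ideal.quotientMap _ (rename (depolarizeVar j) : _ →ₐ[k] _).toRingHom <| by
    rw [monomialIdeal, Ideal.span_le, Set.range_subset_iff]
    intro i
    have : rename (depolarizeVar j) (monomial (polarize a j i) (1 : k)) ∈ monomialIdeal k a := by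
      rw [rename_monomial_polarize]
      exact Ideal.subset_span ⟨i, rfl⟩
    exact this

theorem depolarizeHom_mk (p : MvPolynomial (Option σ) k) :
    depolarizeHom k a j (Ideal.Quotient.mk _ p) =
      Ideal.Quotient.mk _ (rename (depolarizeVar j) p) := rfl

theorem depolarizeHom_surjective : Function.Surjective (depolarizeHom k a j) := by
  intro x
  obtain ⟨p, rfl⟩ := Ideal.Quotient.mk_surjective x
  refine ⟨Ideal.Quotient.mk _ (rename some p), ?_⟩
  rw [depolarizeHom_mk, rename_rename]
  exact congrArg _ (rename_id_apply p)

theorem sub_rename_mem (p : MvPolynomial (Option σ) k) :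
    p - rename some (rename (depolarizeVar j) p) ∈
      Ideal.span {(X none - X (some j) : MvPolynomial (Option σ) k)} := by
  have hφ : (Ideal.Quotient.mkₐ k (Ideal.span {(X none - X (some j) : MvPolynomial (Option σ) k)})).comp
      ((rename some).comp (rename (depolarizeVar j))) = Ideal.Quotient.mkₐ k _ := by
    ext o
    simp only [AlgHom.comp_apply, rename_X]
    cases o with
    | some l => rfl
    | none =>
      rw [eq_comm, ← sub_eq_zero, ← map_sub, Ideal.Quotient.mkₐ_eq_mk,
        Ideal.Quotient.eq_zero_iff_mem]
      exact Ideal.mem_span_singleton_self _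
  rw [← Ideal.Quotient.eq_zero_iff_mem, map_sub, sub_eq_zero]
  exact (congrArg (fun f => f p) hφ).symm

/-- Modulo `y - x_j`, every polynomial agrees with the one in which `y` is replaced by `x_j`. -/
theorem ker_depolarizeHom : RingHom.ker (depolarizeHom k a j) =
    Ideal.span {Ideal.Quotient.mk _ (X none - X (some j))} := by
  apply le_antisymm
  · intro x hx
    obtain ⟨p, rfl⟩ := Ideal.Quotient.mk_surjective x
    rw [RingHom.mem_ker, depolarizeHom_mk, Ideal.Quotient.eq_zero_iff_mem] at hx
    have hle : monomialIdeal k a ≤ (monomialIdeal k (polarize a j) ⊔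
        Ideal.span {(X none - X (some j) : MvPolynomial (Option σ) k)}).comap
          (rename some : MvPolynomial σ k →ₐ[k] _).toRingHom := by
      rw [monomialIdeal, Ideal.span_le, Set.range_subset_iff]
      intro i
      rw [SetLike.mem_coe, Ideal.mem_comap, ← rename_monomial_polarize k a j i]
      have := sub_rename_mem k j (monomial (polarize a j i) 1)
      rw [← sub_sub_cancel (monomial (polarize a j i) 1)
        ((rename some : MvPolynomial σ k →ₐ[k] _).toRingHom _)]
      exact sub_mem (Ideal.mem_sup_left (Ideal.subset_span ⟨i, rfl⟩)) (Ideal.mem_sup_right this)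
    have hx' : rename some (rename (depolarizeVar j) p) ∈ monomialIdeal k (polarize a j) ⊔
        Ideal.span {(X none - X (some j) : MvPolynomial (Option σ) k)} := hle hx
    have hp' := add_mem hx' (Ideal.mem_sup_right (sub_rename_mem k j p))
    rw [add_sub_cancel] at hp'
    obtain ⟨q, hq, r, hr, rfl⟩ := Submodule.mem_sup.mp hp'
    rw [map_add, Ideal.Quotient.eq_zero_iff_mem.mpr hq, zero_add,
      ← Set.image_singleton, ← Ideal.map_span]
    exact Ideal.mem_map_of_mem _ hr
  · rw [Ideal.span_singleton_le_iff_mem, RingHom.mem_ker, depolarizeHom_mk, map_sub, rename_X,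
      rename_X]
    exact (congrArg _ (sub_self _)).trans (map_zero _)

variable {k a} in
theorem IsCohenMacaulayRing.polarize [Finite σ] [Finite ι] (hne : ∀ i, a i ≠ 0)
    (h : IsCohenMacaulayRing (MvPolynomial σ k ⧸ monomialIdeal k a)) :
    IsCohenMacaulayRing (MvPolynomial (Option σ) k ⧸ monomialIdeal k (polarize a j)) := by
  obtain ⟨P, hPp, hP⟩ := exists_origin k a hne
  have hreg : IsSMulRegular (MvPolynomial (Option σ) k ⧸ monomialIdeal k (_root_.polarize a j))
      (Ideal.Quotient.mk (monomialIdeal k (_root_.polarize a j)) (X none - X (some j))) := by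
    refine isSMulRegular_iff_right_eq_zero_of_smul.mpr fun x hx => ?_
    obtain ⟨p, rfl⟩ := Ideal.Quotient.mk_surjective x
    rw [smul_eq_mul, ← map_mul, Ideal.Quotient.eq_zero_iff_mem] at hx
    exact Ideal.Quotient.eq_zero_iff_mem.mpr (mem_monomialIdeal_polarize_of_mul_mem k hx)
  -- Lifting along the regular element only reaches primes containing it; the origin is one of them,
  -- and it suffices.
  have hloc := (isCohenMacaulayLocal_localization_iff_of_regular (depolarizeHom_surjective k a j)
    hreg (ker_depolarizeHom k a j) P).mp (h.2 P)
  refine isCohenMacaulayRing_of_origin (fun o => ?_) hloc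
  rw [Ideal.mem_comap, depolarizeHom_mk, rename_X]
  exact hP _

end Polarization

/-! ### Minimality, Cohen-Macaulayness and codimension under both operations. -/

section Family

variable (k : Type u) [Field k] {σ τ : Type} {ι : Type}

/-- A family of monomials, none of which divides another one, whose quotient ring is Cohen-Macaulay
of codimension `c`. -/
def IsCMFamily (c : ℕ) (a : ι → σ →₀ ℕ) : Prop :=
  (∀ i j, i ≠ j → ¬ a i ≤ a j) ∧
    IsCohenMacaulayRing (MvPolynomial σ k ⧸ monomialIdeal k a) ∧ (monomialIdeal k a).height = c

variable {k} {c : ℕ} {a : ι → σ →₀ ℕ}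

theorem AddMonoidHom.finsupp_nat_monotone (f : (σ →₀ ℕ) →+ (τ →₀ ℕ)) : Monotone f := by
  intro x y hxy
  obtain ⟨z, rfl⟩ := exists_add_of_le hxy
  rw [map_add]
  exact le_self_add

namespace IsCMFamily

theorem ne_zero (h : IsCMFamily k c a) (i : ι) : a i ≠ 0 := by
  revert i
  rw [← monomialIdeal_ne_top_iff (k := k)]
  intro htop
  have := h.2.2
  rw [htop, Ideal.height_top] at this
  exact ENat.top_ne_natCast c this

/-- A homomorphism preserves divisibility, so a divisibility between the `b i` would descend to the
`a i`. -/
theorem not_le_of_hom {b : ι → τ →₀ ℕ} (h : IsCMFamily k c a) (f : (τ →₀ ℕ) →+ (σ →₀ ℕ))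
    (hf : ∀ i, f (b i) = a i) (i j : ι) (hij : i ≠ j) : ¬ b i ≤ b j := fun hle =>
  h.1 i j hij (by rw [← hf, ← hf]; exact f.finsupp_nat_monotone hle)

theorem equivMapDomain (h : IsCMFamily k c a) (e : σ ≃ τ) :
    IsCMFamily k c fun i => (a i).equivMapDomain e := by
  have hmap : monomialIdeal k (fun i => (a i).equivMapDomain e) =
      (monomialIdeal k a).map (renameEquiv k e).toRingEquiv := by
    rw [monomialIdeal, monomialIdeal, Ideal.map_span, ← Set.range_comp]
    congr 2
    ext1 i
    simp [rename_monomial, Finsupp.equivMapDomain_eq_mapDomain]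
  refine ⟨h.not_le_of_hom (Finsupp.domCongr e.symm).toAddMonoidHom fun i => ?_,
    h.2.1.of_ringEquiv (Ideal.quotientEquiv _ _ (renameEquiv k e).toRingEquiv hmap), ?_⟩
  · ext l
    simp [Finsupp.domCongr]
  · rw [hmap, RingEquiv.height_map]
    exact h.2.2

theorem restrictVar [Finite σ] [Finite ι] (h : IsCMFamily k c a) (q : σ)
    (f : ({l // l ≠ q} →₀ ℕ) →+ (σ →₀ ℕ)) (hf : ∀ i, f (restrictVar a q i) = a i) :
    IsCMFamily k c (restrictVar a q) := by
  classical
  have := Fintype.ofFinite σ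
  have hne : ∀ i, _root_.restrictVar a q i ≠ 0 := fun i hi => h.ne_zero i (by
    rw [← hf, hi, map_zero])
  refine ⟨h.not_le_of_hom f hf, h.2.1.restrictVar q hne, ?_⟩
  obtain ⟨⟨D, hD, hDc⟩, hmin⟩ := height_monomialIdeal_eq_iff.mp h.2.2
  refine height_monomialIdeal_eq_iff.mpr ⟨?_, fun C hC => ?_⟩
  · have hcov : IsMonomialCover a (Finset.univ.erase q) := fun i => by
      obtain ⟨l, hl⟩ := Finsupp.ne_iff.mp (hne i)
      exact ⟨l, by simp [l.2], by simpa [_root_.restrictVar] using hl⟩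
    obtain ⟨C, hCle, hC⟩ := Finite.exists_le_minimal (p := IsMonomialCover a) hcov
    have hqC : q ∉ C := fun hq => by simpa using hCle hq
    obtain ⟨P, hPp, hP⟩ := exists_origin k a h.ne_zero
    refine ⟨C.subtype (· ≠ q), fun i => ?_, ?_⟩
    · obtain ⟨l, hl, hil⟩ := hC.1 i
      exact ⟨⟨l, fun h => hqC (h ▸ hl)⟩, by simpa using hl, hil⟩
    · rw [Finset.card_subtype, Finset.filter_true_of_mem (p := (· ≠ q)) fun l hl h => hqC (h ▸ hl)]
      exact le_antisymm (hDc ▸ card_le_card_of_minimal_cover hP (h.2.1.2 P) hC hD) (hmin C hC.1)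
  · refine (hmin (C.map (Function.Embedding.subtype _)) fun i => ?_).trans (by simp)
    obtain ⟨l, hl, hil⟩ := hC i
    exact ⟨l, by simpa using ⟨l.2, hl⟩, hil⟩

theorem polarize [Finite σ] [Finite ι] (h : IsCMFamily k c a) (j : σ) :
    IsCMFamily k c (polarize a j) := by
  classical
  refine ⟨h.not_le_of_hom (Finsupp.mapDomain.addMonoidHom (depolarizeVar j))
    fun i => mapDomain_polarize a j i, h.2.1.polarize j h.ne_zero, ?_⟩
  obtain ⟨⟨D, hD, hDc⟩, hmin⟩ := height_monomialIdeal_eq_iff.mp h.2.2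
  -- In a cover, `j` is replaced by the new variable, which occurs wherever `x_j` did; the old one
  -- survives only where its exponent was at least two.
  refine height_monomialIdeal_eq_iff.mpr ⟨⟨D.image fun l => if l = j then none else some l,
    fun i => ?_, ?_⟩, fun C hC => ?_⟩
  · obtain ⟨l, hl, hil⟩ := hD i
    refine ⟨_, Finset.mem_image_of_mem _ hl, ?_⟩
    split_ifs with hlj
    · subst hlj
      rw [polarize_none]
      lia
    · rwa [polarize_some_ne _ _ _ hlj]
  · rw [Finset.card_image_of_injective _ fun l m hlm => ?_, hDc]
    split_ifs at hlm with h1 h2 h2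
    · exact h1.trans h2.symm
    · simpa using hlm
  · refine (hmin (C.image (depolarizeVar j)) fun i => ?_).trans Finset.card_image_le
    obtain ⟨o, ho, hio⟩ := hC i
    refine ⟨_, Finset.mem_image_of_mem _ ho, ?_⟩
    cases o with
    | none =>
      rw [polarize_none] at hio
      change a i j ≠ 0
      lia
    | some l =>
      change a i l ≠ 0
      by_cases hlj : l = j
      · subst hlj
        rw [polarize_some_self] at hio
        lia
      · rwa [polarize_some_ne _ _ _ hlj] at hio

end IsCMFamily

end Family

end MonomialQuotients

/-! ### Dropping variables and rigidity of squarefree families. -/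

section Restriction

variable {σ : Type} {ι : Type*}

/-- Extension by zero of exponent vectors which do not involve the variable `q`. -/
noncomputable def extendVar (q : σ) : ({l // l ≠ q} →₀ ℕ) →+ (σ →₀ ℕ) :=
  Finsupp.mapDomain.addMonoidHom Subtype.val

theorem extendVar_apply_self (q : σ) (m : {l // l ≠ q} →₀ ℕ) : extendVar q m q = 0 :=
  Finsupp.mapDomain_of_notMem_range _ _ (by simp)

theorem extendVar_apply_ne {q l : σ} (h : l ≠ q) (m : {l // l ≠ q} →₀ ℕ) :
    extendVar q m l = m ⟨l, h⟩ :=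
  Finsupp.mapDomain_apply Subtype.val_injective m ⟨l, h⟩

theorem extendVar_restrictVar_add (a : ι → σ →₀ ℕ) (q : σ) (i : ι) :
    extendVar q (restrictVar a q i) + Finsupp.single q (a i q) = a i := by
  classical
  ext l
  rw [Finsupp.add_apply]
  by_cases h : l = q
  · subst h
    rw [extendVar_apply_self, Finsupp.single_eq_same, zero_add]
  · rw [extendVar_apply_ne h, Finsupp.single_apply, if_neg (Ne.symm h)]
    rfl

/-- Extension of exponent vectors which repeats the exponent at `p` at the variable `q`. -/
noncomputable def mergeVar {p q : σ} (h : p ≠ q) : ({l // l ≠ q} →₀ ℕ) →+ (σ →₀ ℕ) :=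
  extendVar q + (Finsupp.singleAddHom q).comp (Finsupp.applyAddHom ⟨p, h⟩)

theorem mergeVar_apply {p q : σ} (h : p ≠ q) (m : {l // l ≠ q} →₀ ℕ) :
    mergeVar h m = extendVar q m + Finsupp.single q (m ⟨p, h⟩) := rfl

theorem mergeVar_apply_eq {p q : σ} (h : p ≠ q) (m : {l // l ≠ q} →₀ ℕ) :
    mergeVar h m p = mergeVar h m q := by
  classical
  rw [mergeVar_apply, Finsupp.add_apply, Finsupp.add_apply, extendVar_apply_self,
    extendVar_apply_ne h, Finsupp.single_eq_same, Finsupp.single_apply, if_neg h.symm, zero_add,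
    add_zero]

theorem mergeVar_restrictVar {a : ι → σ →₀ ℕ} {p q : σ} (h : p ≠ q) (hpq : ∀ i, a i p = a i q)
    (i : ι) : mergeVar h (restrictVar a q i) = a i := by
  conv_rhs => rw [← extendVar_restrictVar_add a q i, ← hpq i]
  rfl

theorem AddMonoidHom.finsupp_nat_apply {τ : Type*} [Fintype σ] (F : (σ →₀ ℕ) →+ (τ →₀ ℕ))
    (m : σ →₀ ℕ) : F m = ∑ p, m p • F (Finsupp.single p 1) := by
  classical
  conv_lhs => rw [← Finsupp.univ_sum_single m]
  rw [map_sum]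
  refine Finset.sum_congr rfl fun p _ => ?_
  rw [← map_nsmul, Finsupp.smul_single, smul_eq_mul, mul_one]

/-- A squarefree family from which no variable can be dropped has only the trivial endomorphism. -/
theorem endomorphism_eq_id [Finite σ] [Finite ι] {a : ι → σ →₀ ℕ} (hsq : ∀ i p, a i p ≤ 1)
    (hdrop : ∀ (q : σ) (f : ({l // l ≠ q} →₀ ℕ) →+ (σ →₀ ℕ)),
      ¬ ∀ i, f (restrictVar a q i) = a i)
    (F : (σ →₀ ℕ) →+ (σ →₀ ℕ)) (hF : ∀ i, F (a i) = a i) : F = AddMonoidHom.id _ := by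
  classical
  have := Fintype.ofFinite σ
  have := Fintype.ofFinite ι
  have hne : ∀ p, ∃ i, a i p = 1 := by
    intro p
    by_contra! hcon
    refine hdrop p (extendVar p) fun i => ?_
    conv_rhs => rw [← extendVar_restrictVar_add a p i]
    have h0 : a i p = 0 := by have := hsq i p; have := hcon i; lia
    rw [h0, Finsupp.single_zero, add_zero]
  have hinj : ∀ p q, p ≠ q → ∃ i, a i p ≠ a i q := by
    intro p q hpq
    by_contra! hcon
    exact hdrop q (mergeVar hpq) (mergeVar_restrictVar hpq hcon)
  set v : σ → σ →₀ ℕ := fun p => F (Finsupp.single p 1) with hv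
  have hsum : ∀ i l, ∑ p, a i p * v p l = a i l := by
    intro i l
    conv_rhs => rw [← hF i, F.finsupp_nat_apply, Finsupp.finsetSum_apply]
    rfl
  have hle : ∀ p l i, a i p = 1 → v p l ≤ a i l := by
    intro p l i hi
    rw [← hsum i l]
    refine le_trans ?_ (Finset.single_le_sum (f := fun p => a i p * v p l)
      (fun _ _ => Nat.zero_le _) (Finset.mem_univ p))
    simp [hi]
  -- The image of a squarefree generator is squarefree, so two of its variables have images with
  -- disjoint supports.
  have huniq : ∀ p q l i, p ≠ q → a i p = 1 → a i q = 1 → v p l + v q l ≤ 1 := by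
    intro p q l i hpq hp hq
    refine le_trans ?_ ((hsum i l).le.trans (hsq i l))
    have := Finset.sum_le_sum_of_subset (f := fun p => a i p * v p l)
      (Finset.subset_univ ({p, q} : Finset σ))
    rw [Finset.sum_pair hpq] at this
    simpa [hp, hq] using this
  have hbad : ∀ p q, p ≠ q → v p q ≠ 0 → v q q = 0 := by
    intro p q hpq hvq
    obtain ⟨i, hi⟩ := hne p
    have h1 := hle p q i hi
    have h2 := hsq i q
    have := huniq p q q i hpq hi (by lia)
    lia
  -- Take a bad `q` lying in the most generators. If `l` occurs in `v q`, then `l` is bad too and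
  -- lies in every generator containing `q`, hence in exactly the same ones, against `hinj`. So `v q
  -- = 0`, and `q` could be dropped.
  have hgood : ∀ q, v q q ≠ 0 := by
    by_contra! hcon
    obtain ⟨q₀, hq₀⟩ := hcon
    obtain ⟨q, hq, hmax⟩ := Finset.exists_max_image (Finset.univ.filter fun q => v q q = 0)
      (fun q => (Finset.univ.filter fun i => a i q = 1).card) ⟨q₀, by simpa using hq₀⟩
    rw [Finset.mem_filter] at hq
    have hvq : v q = 0 := by
      ext l
      by_contra hl
      have hql : q ≠ l := by
        rintro rfl
        exact hl hq.2
      have hlt := hmax l (by simpa using hbad q l hql hl)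
      have hsub : (Finset.univ.filter fun i => a i q = 1) ⊆
          Finset.univ.filter fun i => a i l = 1 := by
        intro i hi
        simp only [Finset.mem_filter, Finset.mem_univ, true_and] at hi ⊢
        have h1 := hle q l i hi
        have h2 := hsq i l
        rw [Finsupp.coe_zero, Pi.zero_apply] at hl
        lia
      have heq := Finset.eq_of_subset_of_card_le hsub hlt
      obtain ⟨i, hi⟩ := hinj q l hql
      have hiff : a i q = 1 ↔ a i l = 1 := by
        simpa using Finset.ext_iff.mp heq i
      have h1 := hsq i q
      have h2 := hsq i l
      lia
    refine hdrop q (F.comp (extendVar q)) fun i => ?_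
    conv_rhs => rw [← hF i, ← extendVar_restrictVar_add a q i, map_add]
    have : F (Finsupp.single q (a i q)) = 0 := by
      have h1 : Finsupp.single q (a i q) = a i q • Finsupp.single q 1 := by
        rw [Finsupp.smul_single, smul_eq_mul, mul_one]
      rw [h1, map_nsmul]
      exact (congrArg _ hvq).trans (smul_zero _)
    rw [this, add_zero]
    rfl
  refine Finsupp.addHom_ext' fun p => ?_
  ext l
  change v p l = Finsupp.single p 1 l
  rw [Finsupp.single_apply]
  split_ifs with hpl
  · subst hpl
    obtain ⟨i, hi⟩ := hne p
    have := hle p p i hi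
    have := hgood p
    lia
  · by_contra hcon
    exact hgood l (hbad p l hpl hcon)

end Restriction

/-! ### Polarizing until squarefree. -/

section Squarefree

variable {k : Type u} [Field k] {ι : Type} [Finite ι] {c : ℕ}

/-- Iterated polarization. -/
theorem IsCMFamily.exists_squarefree {σ : Type} [Finite σ] {a : ι → σ →₀ ℕ}
    (h : IsCMFamily k c a) : ∃ (τ : Type) (_ : Finite τ) (b : ι → τ →₀ ℕ), IsCMFamily k c b ∧
      (∀ i p, b i p ≤ 1) ∧ ∃ f : (τ →₀ ℕ) →+ (σ →₀ ℕ), ∀ i, f (b i) = a i := by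
  classical
  have := Fintype.ofFinite ι
  have hσ := Fintype.ofFinite σ
  -- The total excess of the exponents over one drops at every step, the new variable contributing
  -- none.
  obtain ⟨m, hm⟩ : ∃ m, ∑ i, ∑ p, (a i p - 1) = m := ⟨_, rfl⟩
  induction m using Nat.strong_induction_on generalizing σ with
  | _ m ih =>
  by_cases hsq : ∀ i p, a i p ≤ 1
  · exact ⟨σ, inferInstance, a, h, hsq, AddMonoidHom.id _, fun _ => rfl⟩
  push Not at hsq
  obtain ⟨i₀, j, hj⟩ := hsq
  have hstep : ∀ i p, _root_.polarize a j i (some p) - 1 ≤ a i p - 1 := by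
    intro i p
    by_cases hp : p = j
    · subst hp
      rw [polarize_some_self]
      lia
    · rw [polarize_some_ne _ _ _ hp]
  have hnone : ∀ i, _root_.polarize a j i none - 1 = 0 := by
    intro i
    rw [polarize_none]
    lia
  have hlt : ∑ i, ∑ o, (_root_.polarize a j i o - 1) < m := by
    rw [← hm]
    refine Finset.sum_lt_sum (fun i _ => ?_) ⟨i₀, Finset.mem_univ _, ?_⟩
    · rw [Fintype.sum_option, hnone, zero_add]
      exact Finset.sum_le_sum fun p _ => hstep i p
    · rw [Fintype.sum_option, hnone, zero_add]
      refine Finset.sum_lt_sum (fun p _ => hstep i₀ p) ⟨j, Finset.mem_univ _, ?_⟩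
      rw [polarize_some_self]
      lia
  obtain ⟨τ, hτ, b, hb, hbsq, f, hf⟩ := ih _ hlt (h.polarize j) inferInstance rfl
  refine ⟨τ, hτ, b, hb, hbsq, (Finsupp.mapDomain.addMonoidHom (depolarizeVar j)).comp f,
    fun i => ?_⟩
  rw [AddMonoidHom.comp_apply, hf]
  exact mapDomain_polarize a j i

end Squarefree

/-! ### Finiteness and existence of maximal objects. -/

namespace CMCat

variable {k : Type u} [Field k] {n c : ℕ}

theorem isCMFamily (A : CMCat k n c) : IsCMFamily k c A.obj.gen := A.property

/-- A morphism given by a homomorphism of semigroups. -/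
noncomputable def ofHom {A B : CMCat k n c} (f : (Fin A.obj.rank →₀ ℕ) →+ (Fin B.obj.rank →₀ ℕ))
    (hf : ∀ i, f (A.obj.gen i) = B.obj.gen i) : A ⟶ B :=
  ObjectProperty.homMk (MonTuple.Hom.mk f hf : MonTuple.Hom A.obj B.obj)

theorem hom_ext_toHom {A B : CMCat k n c} {f g : A ⟶ B} (h : f.hom.toHom = g.hom.toHom) : f = g :=
  ObjectProperty.hom_ext _ (MonTuple.Hom.ext h)

theorem exists_of_isCMFamily {σ : Type} [Finite σ] {a : Fin n → σ →₀ ℕ} (h : IsCMFamily k c a) :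
    ∃ (A : CMCat k n c) (e : (σ →₀ ℕ) ≃+ (Fin A.obj.rank →₀ ℕ)), A.obj.rank = Nat.card σ ∧
      (∀ i, e (a i) = A.obj.gen i) ∧ ((∀ i l, a i l ≤ 1) → A.obj.IsSquarefree) :=
  ⟨⟨⟨Nat.card σ, fun i => (a i).equivMapDomain (Finite.equivFin σ)⟩,
    h.equivMapDomain (Finite.equivFin σ)⟩, Finsupp.domCongr (Finite.equivFin σ), rfl,
    fun _ => rfl, fun hsq i _ => hsq i _⟩

theorem exists_squarefree (A : CMCat k n c) :
    ∃ B : CMCat k n c, B.obj.IsSquarefree ∧ Nonempty (B ⟶ A) := by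
  obtain ⟨τ, _, b, hb, hsq, f, hf⟩ := A.isCMFamily.exists_squarefree
  obtain ⟨B, e, -, he, hBsq⟩ := exists_of_isCMFamily hb
  refine ⟨B, hBsq hsq, ⟨ofHom (f.comp e.symm.toAddMonoidHom) fun i => ?_⟩⟩
  rw [← he]
  simpa using hf i

/-- The control on the image serves to contradict surjectivity when `B` is maximal. -/
theorem exists_drop (B : CMCat k n c) (q : Fin B.obj.rank)
    (f : ({l // l ≠ q} →₀ ℕ) →+ (Fin B.obj.rank →₀ ℕ))
    (hf : ∀ i, f (restrictVar B.obj.gen q i) = B.obj.gen i) :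
    ∃ (B' : CMCat k n c) (φ : B' ⟶ B), B'.obj.rank < B.obj.rank ∧
      (B.obj.IsSquarefree → B'.obj.IsSquarefree) ∧ ∀ x, ∃ y, φ.hom.toHom x = f y := by
  obtain ⟨B', e, hrank, he, hsq⟩ := exists_of_isCMFamily (B.isCMFamily.restrictVar q f hf)
  refine ⟨B', ofHom (f.comp e.symm.toAddMonoidHom) fun i => ?_, ?_, fun h => hsq fun i l => h i l,
    fun x => ⟨e.symm x, rfl⟩⟩
  · rw [← he]
    simpa using hf i
  · rw [hrank, Nat.card_eq_fintype_card]
    exact (Fintype.card_subtype_lt (x := q) (by simp)).trans_eq (Fintype.card_fin _)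

/-- The section sends `e_p` to a nonzero vector, so some coordinate of the image of a generator is
at least its exponent at `p`. -/
theorem isSquarefree_of_split {A B : CMCat k n c} (hB : B.obj.IsSquarefree) (φ : B ⟶ A)
    (ψ : A ⟶ B) (h : ψ ≫ φ = 𝟙 A) : A.obj.IsSquarefree := by
  intro i p
  have hψφ : ∀ x, φ.hom.toHom (ψ.hom.toHom x) = x := fun x =>
    congrArg (fun f : A ⟶ A => f.hom.toHom x) h
  obtain ⟨l, hl⟩ : ∃ l, ψ.hom.toHom (Finsupp.single p 1) l ≠ 0 := by
    by_contra! hcon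
    have h0 : ψ.hom.toHom (Finsupp.single p 1) = 0 := Finsupp.ext hcon
    have := hψφ (Finsupp.single p 1)
    rw [h0, map_zero, eq_comm, Finsupp.single_eq_zero] at this
    exact one_ne_zero this
  have hle : Finsupp.single p (A.obj.gen i p) ≤ A.obj.gen i := Finsupp.single_le_iff.mpr le_rfl
  have h1 := ψ.hom.toHom.finsupp_nat_monotone hle l
  have hs : Finsupp.single p (A.obj.gen i p) = A.obj.gen i p • Finsupp.single p 1 := by
    rw [Finsupp.smul_single, smul_eq_mul, mul_one]
  rw [ψ.hom.map_gen, hs, map_nsmul, Finsupp.smul_apply, smul_eq_mul] at h1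
  exact (Nat.le_mul_of_pos_right _ (Nat.pos_of_ne_zero hl)).trans (h1.trans (hB i l))

/-- A variable is determined by the set of generators it divides. -/
theorem rank_le_of_forall_ne {A : MonTuple n} (hsq : A.IsSquarefree)
    (h : ∀ p q, p ≠ q → ∃ i, A.gen i p ≠ A.gen i q) : A.rank ≤ 2 ^ n := by
  have hinj : Function.Injective fun (p : Fin A.rank) (i : Fin n) => decide (A.gen i p = 1) := by
    intro p q hpq
    by_contra hne
    obtain ⟨i, hi⟩ := h p q hne
    have h1 := congrFun hpq i
    have h2 := hsq i p
    have h3 := hsq i q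
    simp only [decide_eq_decide] at h1
    lia
  simpa using Fintype.card_le_of_injective _ hinj

theorem exists_rank_le (A : CMCat k n c) : ∃ B : CMCat k n c, B.obj.IsSquarefree ∧
    B.obj.rank ≤ 2 ^ n ∧ Nonempty (B ⟶ A) := by
  obtain ⟨B, hB, ⟨φ⟩⟩ := A.exists_squarefree
  obtain ⟨r, hr⟩ : ∃ r, B.obj.rank = r := ⟨_, rfl⟩
  induction r using Nat.strong_induction_on generalizing B with
  | _ r ih =>
  by_cases h : ∀ p q, p ≠ q → ∃ i, B.obj.gen i p ≠ B.obj.gen i q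
  · exact ⟨B, hB, rank_le_of_forall_ne hB h, ⟨φ⟩⟩
  · push Not at h
    obtain ⟨p, q, hpq, heq⟩ := h
    obtain ⟨B', ψ, hlt, hsq, -⟩ := B.exists_drop q (mergeVar hpq) (mergeVar_restrictVar hpq heq)
    exact ih _ (hr ▸ hlt) B' (hsq hB) (ψ ≫ φ) rfl

variable (k n c) in
theorem finite_squarefree_rank_le (N : ℕ) :
    {A : CMCat k n c | A.obj.IsSquarefree ∧ A.obj.rank ≤ N}.Finite := by
  have hinj : Function.Injective (ObjectProperty.FullSubcategory.obj : CMCat k n c → MonTuple n) :=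
    fun A B h => by
      cases A; cases B; cases h; rfl
  refine Set.Finite.of_finite_image (Set.Finite.subset (Set.finite_range
    fun x : Σ r : Fin (N + 1), Fin n → Fin r → Fin 2 => (⟨x.1, fun i =>
      Finsupp.equivFunOnFinite.symm fun p => (x.2 i p : ℕ)⟩ : MonTuple n)) ?_) hinj.injOn
  rintro _ ⟨A, ⟨hsq, hr⟩, rfl⟩
  refine ⟨⟨⟨A.obj.rank, by lia⟩, fun i p => ⟨A.obj.gen i p, Nat.lt_succ_of_le (hsq i p)⟩⟩, ?_⟩
  obtain ⟨⟨r, g⟩, hA⟩ := A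
  dsimp only
  congr 1
  ext i p
  rfl

theorem IsMaximal.isSquarefree {A : CMCat k n c} (h : A.IsMaximal) : A.obj.IsSquarefree := by
  obtain ⟨B, hB, ⟨φ⟩⟩ := A.exists_squarefree
  obtain ⟨-, ψ, hψ⟩ := h B φ
  exact isSquarefree_of_split hB φ ψ hψ

/-- If `p` and `q` have equal exponents throughout, the morphism repeating the coordinate `p` at `q`
misses `e_q`. -/
theorem IsMaximal.rank_le {A : CMCat k n c} (h : A.IsMaximal) : A.obj.rank ≤ 2 ^ n := by
  refine rank_le_of_forall_ne h.isSquarefree ?_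
  by_contra! hcon
  obtain ⟨p, q, hpq, heq⟩ := hcon
  obtain ⟨B, φ, -, -, hφ⟩ := A.exists_drop q (mergeVar hpq) (mergeVar_restrictVar hpq heq)
  obtain ⟨x, hx⟩ := (h B φ).1 (Finsupp.single q 1)
  obtain ⟨y, hy⟩ := hφ x
  have := mergeVar_apply_eq hpq y
  rw [← hy, hx, Finsupp.single_eq_same, Finsupp.single_apply, if_neg hpq.symm] at this
  exact zero_ne_one this

/-- Among the squarefree objects of bounded rank over a given object there is one which is minimal
for the existence of morphisms and then for the rank. -/
theorem exists_minimal (A : CMCat k n c) : ∃ B : CMCat k n c, B.obj.IsSquarefree ∧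
    B.obj.rank ≤ 2 ^ n ∧ Nonempty (B ⟶ A) ∧ ∀ C : CMCat k n c, C.obj.IsSquarefree →
      C.obj.rank ≤ 2 ^ n → Nonempty (C ⟶ B) → Nonempty (B ⟶ C) ∧ B.obj.rank ≤ C.obj.rank := by
  let above : CMCat k n c → Set (CMCat k n c) := fun B =>
    {C | (C.obj.IsSquarefree ∧ C.obj.rank ≤ 2 ^ n) ∧ Nonempty (C ⟶ B)}
  have hfin : ∀ B, (above B).Finite := fun B =>
    (finite_squarefree_rank_le k n c (2 ^ n)).subset fun C hC => hC.1
  -- A lexicographic measure: the factor `2 ^ n + 1` exceeds every admissible rank, so the number of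
  -- objects above `B` counts first.
  let μ : CMCat k n c → ℕ := fun B => (above B).ncard * (2 ^ n + 1) + B.obj.rank
  obtain ⟨B₀, h1, h2, h3⟩ := A.exists_rank_le
  obtain ⟨B, ⟨⟨hsq, hr⟩, hBA⟩, hmin⟩ :=
    WellFounded.has_min (measure μ).wf (above A) ⟨B₀, ⟨h1, h2⟩, h3⟩
  refine ⟨B, hsq, hr, hBA, fun C hCsq hCr ⟨φ⟩ => ?_⟩
  have hμ : μ B ≤ μ C := not_lt.mp (hmin C ⟨⟨hCsq, hCr⟩, hBA.map fun ψ => φ ≫ ψ⟩)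
  have hsub : above C ⊆ above B := fun D hD => ⟨hD.1, hD.2.map fun ψ => ψ ≫ φ⟩
  have hcard := Set.ncard_le_ncard hsub (hfin B)
  simp only [μ] at hμ
  constructor
  · by_contra hcon
    have hlt : (above C).ncard < (above B).ncard := Set.ncard_lt_ncard
      ⟨hsub, fun hle => hcon (hle ⟨⟨hsq, hr⟩, ⟨𝟙 B⟩⟩).2⟩ (hfin B)
    nlinarith
  · have := Nat.mul_le_mul_right (2 ^ n + 1) hcard
    lia

theorem exists_isMaximal (A : CMCat k n c) : ∃ B : CMCat k n c, B.IsMaximal ∧ Nonempty (B ⟶ A) := by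
  obtain ⟨B, hsq, hr, hBA, hmin⟩ := A.exists_minimal
  refine ⟨B, fun C φ => ?_, hBA⟩
  -- A droppable variable would give a squarefree object over `B` of smaller rank, against
  -- minimality.
  have hendo : ∀ f : B ⟶ B, f = 𝟙 B := fun f => by
    refine hom_ext_toHom (endomorphism_eq_id hsq (fun q g hg => ?_) f.hom.toHom f.hom.map_gen)
    obtain ⟨B', ψ, hlt, hsq', -⟩ := B.exists_drop q g hg
    have := (hmin B' (hsq' hsq) (by lia) ⟨ψ⟩).2
    lia
  obtain ⟨D, hDsq, hDr, ⟨χ⟩⟩ := C.exists_rank_le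
  obtain ⟨⟨ψ⟩, -⟩ := hmin D hDsq hDr ⟨χ ≫ φ⟩
  have hsplit : (ψ ≫ χ) ≫ φ = 𝟙 B := hendo _
  exact ⟨fun x => ⟨(ψ ≫ χ).hom.toHom x, congrArg (fun f : B ⟶ B => f.hom.toHom x) hsplit⟩,
    ψ ≫ χ, hsplit⟩

end CMCat

theorem proposition1p6 (k : Type*) [Field k] (n c : ℕ) :
    {A : CMCat k n c | A.IsMaximal}.Finite ∧
      (∀ A : CMCat k n c, A.IsMaximal → A.obj.IsSquarefree) ∧
      ∀ A : CMCat k n c, ∃ B : CMCat k n c, B.IsMaximal ∧ Nonempty (B ⟶ A) :=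
  ⟨(CMCat.finite_squarefree_rank_le k n c (2 ^ n)).subset fun _ hA =>
    ⟨hA.isSquarefree, hA.rank_le⟩, fun _ hA => hA.isSquarefree, fun A => A.exists_isMaximal⟩
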